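/- **Setting.** Fix a box length $L>0$, a finite set $K\subset\frac{2\pi}{L}\mathbb Z^3$ of $N_m$ Fourier modes, an integrable shape function $S:\mathbb R^3\to\mathbb R$ with Fourier transform $S_{\mathbf k}=\int S(\mathbf x)e^{-i\mathbf k\cdot\mathbf x}\,d\mathbf x$, a particle charge $q_e\in\mathbb R$ and mass $m_e>0$, a static external magnetic field $\mathbf B_{ext}\in C^2(\mathbb R^3;\mathbb R^3)$, and a number $N_p$ of particles. The particle-in-Fourier (PIF) equations for $\mathbf u=(\mathbf x,\mathbf v)\in(\mathbb R^3)^{N_p}\times(\mathbb R^3)^{N_p}$ are $$\dot{\mathbf x}=\mathbf v,\qquad \dot{\mathbf v}_j=\tfrac{q_e}{m_e}\Big(\operatorname{Re}\big(\mathbf P^H\mathbf L\mathbf P\,\mathbf q_e\big)_j+\mathbf v_j\times\mathbf B_{ext}(\mathbf x_j)\Big),$$ where $\mathbf q_e=q_e(1,\dots,1)$, $\mathbf P_{lj}=L^{-3/2}S_{\mathbf k_l}e^{-i\mathbf k_l\cdot\mathbf x_j}$ (NUDFT) and $\mathbf L$ is diagonal with the vector entries $-i\mathbf k/|\mathbf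 k|^2$ ($0$ for $\mathbf k=0$). The NUFFT PIF equations are the same (same particles, modes and shape function) with $e^{-i\mathbf k\cdot\mathbf x}$ replaced by its type 1 NUFFT approximation $a_{\mathbf k}(\mathbf x)=d_{\mathbf k}\sum_{l}\kappa(\mathbf y_l-\mathbf x)e^{-i\mathbf k\cdot\mathbf y_l}$ ($\kappa$ an $L$-periodic spreading kernel, $\mathbf y_l$ the points of a uniform grid, $d_{\mathbf k}\in\mathbb C$ correction factors); $\mathbf P^H$ is replaced by the adjoint (type 2) matrix. The NUFFT has tolerance $\varepsilon\in(0,1]$ with constant $c$ if for every $\mathbf k\in K$ the error $a_{\mathbf k}(\mathbf x)-e^{-i\mathbf k\cdot\mathbf x}$ is bounded by $c\,\varepsilon$ and is Lipschitz in $\mathbf x$ with constant $c\,\varepsilon$. Let $\|\cdot\|$ be any norm on phase space. **Propagators.** Let $\varphi_t$ and $\psi_t$ be the exact flows of the PIF equations with NUDFT and with NUFFT. The fine propagator is $\mathbf F=\varphi_{\Delta T}$. The coarse propagator is $\mathbf G=\Phi^{n_g}$, i.e. $n_g\ge1$ steps of a one-step map $\Phi$ with step size $\Delta t_g>0$, $\Delta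 T=n_g\Delta t_g$. Let $D$ be a set of phase-space states, which may be all of phase space, and which is assumed bounded if $\mathbf B_{ext}$ is not spatially constant. Assume that $\Phi$ has local truncation error of order $p+1$ on $D$ with constant $C_{lte}$: the defect $d=\Phi-\psi_{\Delta t_g}$ satisfies $\|d(u)\|\le C_{lte}\Delta t_g^{p+1}$ and $\|d(u)-d(w)\|\le C_{lte}\Delta t_g^{p+1}\|u-w\|$ for $u,w\in D$; and that $\mathbf G$ has Lipschitz constant $C_{pif}$ on $D$. **Parareal.** Given an initial condition $u^0$ and arbitrary initial guesses $U^0_n$ ($n\ge1$), put $U^k_0=u^0$ and $U^{k+1}_{n+1}=\mathbf F(U^k_n)+\mathbf G(U^{k+1}_n)-\mathbf G(U^k_n)$. Let $u_n=\varphi_{n\Delta T}(u^0)$ be the exact PIF solution, $e^k_n=\|U^k_n-u_n\|$, and $\delta=\max_{n=1,\dots,N}e^0_n$, where $N$ is the number of time subdomains. Assume that the states at which a step $\Phi$ starts in the evaluations of $\mathbf G$ at $U_n^k$ and $u_n$ ($0\le n<N$, $k\ge0$) lie in $D$. **Theorem.** For each $T$ there are constants $C_{nufft}\ge0$ and $C_{time}\ge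 0$ such that, whenever $\Delta T\le T$, for all $k\ge0$ and $0\le n<N$, $$e_{n+1}^k\le\bar C^{\,n-k}\,\frac{\big(C_{nufft}\,\varepsilon+C_{time}\,\Delta T\,\Delta t_g^{p}\big)^k}{k!}\,\prod_{j=1}^k(n+1-j)\;\delta,\qquad \bar C=\max(1,C_{pif}).$$ Besides the fixed data (the PIF system, $N_p$, the norm, $D$ and $T$), $C_{nufft}$ depends only on the constant $c$ of the NUFFT, and $C_{time}$ only on $p$ and the local truncation constant $C_{lte}$ of the time integrator; in particular neither depends on $\varepsilon$, $\Delta t_g$, $n_g$, $\Delta T$, $C_{pif}$, $N$, $n$, $k$, $u^0$ or the initial guesses. -/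

import Mathlib

noncomputable section

/-- Vectors of three-dimensional configuration or velocity space. -/
abbrev Vec3 : Type := Fin 3 → ℝ

/-- Phase space of `Np` particles: all positions together with all velocities. -/
abbrev Phase (Np : ℕ) : Type := (Fin Np → Vec3) × (Fin Np → Vec3)

/-- The wave vector `(2π / L) κ` of the integer mode index `κ`. -/
def waveVector (L : ℝ) (κ : Fin 3 → ℤ) : Vec3 := fun a => 2 * Real.pi / L * (κ a : ℝ)

/-- The Fourier exponential `exp (-i k · x)` with `k = (2π / L) κ`. -/
def fourierExp (L : ℝ) (κ : Fin 3 → ℤ) (x : Vec3) : ℂ :=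
  Complex.exp (-Complex.I * ((waveVector L κ ⬝ᵥ x : ℝ) : ℂ))

/-- Data of an electrostatic particle-in-Fourier (PIF) discretization of the Vlasov-Poisson system
in the periodic box of side `L`. The finite set `modes` of mode indices `κ` stands for the wave
vectors `(2π / L) κ`. -/
structure PIFModel where
  L : ℝ
  L_pos : 0 < L
  modes : Finset (Fin 3 → ℤ)
  shape : Vec3 → ℝ
  shape_integrable : MeasureTheory.Integrable shape
  charge : ℝ
  mass : ℝ
  mass_pos : 0 < mass
  Bext : Vec3 → Vec3
  Bext_contDiff : ContDiff ℝ 2 Bext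

namespace PIFModel

variable (𝓜 : PIFModel) {Np : ℕ}

/-- Fourier transform `S_k` of the shape function. -/
def shapeCoeff (κ : Fin 3 → ℤ) : ℂ := ∫ x : Vec3, (𝓜.shape x : ℂ) * fourierExp 𝓜.L κ x

/-- The particle-to-Fourier matrix `P = L^{-3/2} S_k A` belonging to a matrix `A` of (exact or
approximate) Fourier exponentials `exp (-i k_l · x_j)`. -/
def scatter (A : Matrix 𝓜.modes (Fin Np) ℂ) : Matrix 𝓜.modes (Fin Np) ℂ :=
  (((Real.sqrt (𝓜.L ^ 3))⁻¹ : ℝ) : ℂ) •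
    (Matrix.diagonal (fun l : 𝓜.modes => 𝓜.shapeCoeff l) * A)

/-- Component `a` of the diagonal matrix with entries `-i k / |k|²` mapping density to electric
field; the entry of the mode `k = 0` is `0` (neutralizing background). -/
def fieldSolve (a : Fin 3) : Matrix 𝓜.modes 𝓜.modes ℂ :=
  Matrix.diagonal fun l : 𝓜.modes =>
    -Complex.I * ((waveVector 𝓜.L l a / (waveVector 𝓜.L l ⬝ᵥ waveVector 𝓜.L l) : ℝ) : ℂ)

/-- The electric field `Pᴴ 𝐋 P q` at particle `j`, where `q` is the vector with all entries equal
to the particle charge. The real part is the physical field (on a set of modes that is not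
symmetric under `k ↦ -k` the sum itself need not be real). -/
def electricField (P : Matrix 𝓜.modes (Fin Np) ℂ) (j : Fin Np) : Vec3 := fun a =>
  (((P.conjTranspose * 𝓜.fieldSolve a * P).mulVec fun _ => (𝓜.charge : ℂ)) j).re

/-- Right-hand side of the particle equations `x' = v`, `v' = (q/m) (Pᴴ 𝐋 P q + v × B_ext)`, where
`A x` is the matrix of (exact or approximate) exponentials at the positions `x`. -/
def rhs (A : (Fin Np → Vec3) → Matrix 𝓜.modes (Fin Np) ℂ) (u : Phase Np) : Phase Np :=
  (u.2, fun j => (𝓜.charge / 𝓜.mass) •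
    (𝓜.electricField (𝓜.scatter (A u.1)) j + crossProduct (u.2 j) (𝓜.Bext (u.1 j))))

/-- The nonuniform discrete Fourier transform (NUDFT) matrix, with entries `exp (-i k_l · x_j)`. -/
def nudft (x : Fin Np → Vec3) : Matrix 𝓜.modes (Fin Np) ℂ :=
  Matrix.of fun l j => fourierExp 𝓜.L l (x j)

end PIFModel

/-- A nonuniform fast Fourier transform (NUFFT) on the periodic box of side `L`: spreading with the
periodized `kernel` to a uniform grid with `gridSize` points per direction, uniform Fourier
transform on that grid, and multiplication of every mode by its `correction` factor. -/
structure NUFFT (L : ℝ) where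
  gridSize : ℕ
  kernel : Vec3 → ℝ
  kernel_periodic : ∀ (x : Vec3) (m : Fin 3 → ℤ), kernel (fun a => x a + L * (m a : ℝ)) = kernel x
  correction : (Fin 3 → ℤ) → ℂ

namespace NUFFT

variable {L : ℝ} (𝓝 : NUFFT L)

/-- Points of the uniform grid. -/
def gridPoint (l : Fin 3 → Fin 𝓝.gridSize) : Vec3 :=
  fun a => L / (𝓝.gridSize : ℝ) * ((l a : ℕ) : ℝ)

/-- Output of the type 1 NUFFT in mode `κ` for a unit source at `x`: the approximation of
`exp (-i k · x)`. -/
def approxExp (κ : Fin 3 → ℤ) (x : Vec3) : ℂ :=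
  𝓝.correction κ * ∑ l : Fin 3 → Fin 𝓝.gridSize,
    (𝓝.kernel (𝓝.gridPoint l - x) : ℂ) * fourierExp L κ (𝓝.gridPoint l)

/-- The NUFFT has tolerance `ε`, with constant `c`, on the given modes: the error of the computed
exponentials is at most `c ε` in the Lipschitz norm with respect to the source position, that is,
both in absolute value and in its Lipschitz constant. -/
def HasTolerance (modes : Finset (Fin 3 → ℤ)) (c ε : ℝ) : Prop :=
  ∀ κ ∈ modes, ∀ x y : Vec3,
    ‖𝓝.approxExp κ x - fourierExp L κ x‖ ≤ c * ε ∧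
    ‖(𝓝.approxExp κ x - fourierExp L κ x) - (𝓝.approxExp κ y - fourierExp L κ y)‖
      ≤ c * ε * ‖x - y‖

end NUFFT

/-- The type 1 NUFFT matrix at the particle positions `x` (its conjugate transpose is the type 2
NUFFT matrix). -/
def PIFModel.nufft (𝓜 : PIFModel) {Np : ℕ} (𝓝 : NUFFT 𝓜.L) (x : Fin Np → Vec3) :
    Matrix 𝓜.modes (Fin Np) ℂ :=
  Matrix.of fun l j => 𝓝.approxExp l (x j)

/-- `φ t u` is the solution at time `t` of `y' = f y`, `y 0 = u`. -/
def IsFlow {E : Type*} [NormedAddCommGroup E] [NormedSpace ℝ E] (f : E → E) (φ : ℝ → E → E) :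
    Prop :=
  ∀ u : E, φ 0 u = u ∧ ∀ t : ℝ, HasDerivAt (fun s => φ s u) (f (φ t u)) t

/-- The one-step map `Φ` with step size `dt` has, at the states in `D`, a local truncation error of
at most `C dt^(p+1)` against the exact flow `ψ`: this holds for the size and for the Lipschitz
constant of the one-step defect `u ↦ Φ u - ψ dt u`. -/
def LocalTruncationBound {E : Type*} [AddCommGroup E] [Module ℝ E] (ν : Seminorm ℝ E) (D : Set E)
    (ψ : ℝ → E → E) (Φ : E → E) (dt : ℝ) (p : ℕ) (C : ℝ) : Prop :=
  ∀ u ∈ D, ∀ w ∈ D,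
    ν (Φ u - ψ dt u) ≤ C * dt ^ (p + 1) ∧
    ν ((Φ u - ψ dt u) - (Φ w - ψ dt w)) ≤ C * dt ^ (p + 1) * ν (u - w)

/-- The parareal iterates: `parareal F G u₀ g k n` is `U_n^k`. The initial guess is `U_0^0 = u₀`
and `U_n^0 = g n` for `n ≥ 1`. -/
def parareal {E : Type*} [AddCommGroup E] (F G : E → E) (u₀ : E) (g : ℕ → E) : ℕ → ℕ → E
  | _, 0 => u₀
  | 0, n + 1 => g (n + 1)
  | k + 1, n + 1 =>
      F (parareal F G u₀ g k n) + G (parareal F G u₀ g (k + 1) n) - G (parareal F G u₀ g k n)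

end

/-! Since u_{n+1} = F(u_n), the parareal error splits into (F - G)(U^k_n) - (F - G)(u_n) and
G(U^{k+1}_n) - G(u_n). If α is a Lipschitz constant of F - G at the relevant states, then
e^{k+1}_{n+1} ≤ α e^k_n + C̄ e^{k+1}_n. With e^k_0 = 0, Pascal's rule yields the bound C̄^{n-k} α^k
(n choose k) δ (`le_of_parareal_recursion`).

The work lies in α = C_nufft ε + C_time ΔT dt^p (`exists_propagator_diff_bound`). The one-step
defect is Φ - φ_dt = (Φ - ψ_dt) + (ψ_dt - φ_dt). The first part is controlled by assumption. For the
second, the two vector fields differ by O(ε) both in size and in Lipschitz constant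
(`exists_rhsError_bound`), and Grönwall passes this on to the flows
(`IsFlow.norm_perturbed_sub_le`). Telescoping over the coarse steps transports each defect by φ_s
(`IsFlow.norm_sub_iterate_sub_le`). Comparing transported defects at two states is a four-point
estimate, which the Lipschitz constant of φ_s alone does not give. It follows from `QuadLip`, which
the flow inherits from its vector field (`IsFlow.quadLip`). Stated with four points, the condition
needs neither a convex domain nor differentiability of the flow in its initial state.

The constants must be uniform along trajectories. The electric field is a trigonometric sum, hence
harmless globally; for a nonconstant magnetic field, trajectories starting in a bounded set are
confined to a ball (`exists_confining_set`). -/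

open Set

/-- Second-order Lipschitz condition on `S`: a difference version of bounds `A` on the first and
`B` on the second derivative. -/
def QuadLip {E F : Type*} [NormedAddCommGroup E] [NormedAddCommGroup F]
    (f : E → F) (S : Set E) (A B : ℝ) : Prop :=
  ∀ x ∈ S, ∀ y ∈ S, ∀ x' ∈ S, ∀ y' ∈ S,
    ‖f x - f y - (f x' - f y')‖ ≤
      A * ‖x - y - (x' - y')‖ + B * (‖x - x'‖ + ‖y - y'‖) * ‖x' - y'‖

/-- A form without division by `K`, so that `K = 0` needs no separate treatment later and the factor
`t` stays visible. -/
theorem gronwallBound_le_mul_exp {δ K ε t : ℝ} (hK : 0 ≤ K) (hε : 0 ≤ ε) :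
    gronwallBound δ K ε t ≤ (δ + ε * t) * Real.exp (K * t) := by
  rcases hK.eq_or_lt with rfl | hK
  · simp [gronwallBound_K0]
  · rw [gronwallBound_of_K_ne_0 hK.ne']
    have h1 : Real.exp (K * t) - 1 ≤ K * t * Real.exp (K * t) := by
      have h2 := Real.add_one_le_exp (-(K * t))
      have h3 : Real.exp (-(K * t)) * Real.exp (K * t) = 1 := by
        rw [← Real.exp_add]; simp
      nlinarith [Real.exp_pos (K * t)]
    have h4 : ε / K * (Real.exp (K * t) - 1) ≤ ε / K * (K * t * Real.exp (K * t)) :=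
      mul_le_mul_of_nonneg_left h1 (div_nonneg hε hK.le)
    have h5 : ε / K * (K * t * Real.exp (K * t)) = ε * t * Real.exp (K * t) := by
      field_simp
    linarith

/-! ### Calculus of second-order Lipschitz bounds. -/

namespace QuadLip

variable {E F : Type*} [NormedAddCommGroup E] [NormedAddCommGroup F]
  {f g : E → F} {S : Set E} {A B A' B' : ℝ}

theorem norm_sub_le (h : QuadLip f S A B) {x y : E} (hx : x ∈ S) (hy : y ∈ S) :
    ‖f x - f y‖ ≤ A * ‖x - y‖ := by
  simpa using h x hx y hy y hy y hy

theorem mono (h : QuadLip f S A B) (hA : A ≤ A') (hB : B ≤ B') : QuadLip f S A' B' := by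
  intro x hx y hy x' hx' y' hy'
  refine (h x hx y hy x' hx' y' hy').trans ?_
  gcongr

theorem add (hf : QuadLip f S A B) (hg : QuadLip g S A' B') :
    QuadLip (fun x => f x + g x) S (A + A') (B + B') := by
  intro x hx y hy x' hx' y' hy'
  have h1 := hf x hx y hy x' hx' y' hy'
  have h2 := hg x hx y hy x' hx' y' hy'
  have h3 : f x + g x - (f y + g y) - (f x' + g x' - (f y' + g y')) =
    (f x - f y - (f x' - f y')) + (g x - g y - (g x' - g y')) := by abel
  rw [h3]
  refine (norm_add_le _ _).trans ((add_le_add h1 h2).trans (le_of_eq (by ring)))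

theorem zero : QuadLip (fun _ : E => (0 : F)) S 0 0 := by
  intro x hx y hy x' hx' y' hy'
  simp

theorem sum {ι : Type*} (s : Finset ι) {f : ι → E → F} {A B : ι → ℝ}
    (h : ∀ i ∈ s, QuadLip (f i) S (A i) (B i)) :
    QuadLip (fun x => ∑ i ∈ s, f i x) S (∑ i ∈ s, A i) (∑ i ∈ s, B i) := by
  classical
  induction s using Finset.induction_on with
  | empty => simpa using zero
  | insert a s ha ih =>
    simp only [Finset.sum_insert ha]
    exact (h a (Finset.mem_insert_self _ _)).add
      (ih fun i hi => h i (Finset.mem_insert_of_mem hi))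

theorem clm_comp [NormedSpace ℝ F] {G : Type*} [NormedAddCommGroup G] [NormedSpace ℝ G] (l : F →L[ℝ] G)
    (h : QuadLip f S A B) : QuadLip (fun x => l (f x)) S (‖l‖ * A) (‖l‖ * B) := by
  intro x hx y hy x' hx' y' hy'
  simp only [← map_sub]
  refine (l.le_opNorm _).trans ?_
  refine (mul_le_mul_of_nonneg_left (h x hx y hy x' hx' y' hy') (norm_nonneg _)).trans
    (le_of_eq (by ring))

theorem comp_clm [NormedSpace ℝ E] {G : Type*} [NormedAddCommGroup G] [NormedSpace ℝ G] (l : G →L[ℝ] E)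
    (hA : 0 ≤ A) (hB : 0 ≤ B) {S' : Set G} (hS : MapsTo l S' S) (h : QuadLip f S A B) :
    QuadLip (fun x => f (l x)) S' (A * ‖l‖) (B * ‖l‖ * ‖l‖) := by
  intro x hx y hy x' hx' y' hy'
  refine (h _ (hS hx) _ (hS hy) _ (hS hx') _ (hS hy')).trans ?_
  simp only [← map_sub]
  have h1 := l.le_opNorm (x - y - (x' - y'))
  have h2 := l.le_opNorm (x - x')
  have h3 := l.le_opNorm (y - y')
  have h4 := l.le_opNorm (x' - y')
  calc _ ≤ A * (‖l‖ * ‖x - y - (x' - y')‖) +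
        B * (‖l‖ * ‖x - x'‖ + ‖l‖ * ‖y - y'‖) * (‖l‖ * ‖x' - y'‖) := by gcongr
    _ = _ := by ring

theorem clm [NormedSpace ℝ E] [NormedSpace ℝ F] (l : E →L[ℝ] F) : QuadLip (fun x => l x) S ‖l‖ 0 := by
  intro x hx y hy x' hx' y' hy'
  simp only [← map_sub, zero_mul, add_zero]
  exact l.le_opNorm _

theorem pi {ι : Type*} [Fintype ι] {F : ι → Type*} [∀ i, NormedAddCommGroup (F i)]
    {f : E → ∀ i, F i} (hA : 0 ≤ A) (hB : 0 ≤ B) (h : ∀ i, QuadLip (fun x => f x i) S A B) :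
    QuadLip f S A B := by
  intro x hx y hy x' hx' y' hy'
  refine (pi_norm_le_iff_of_nonneg (by positivity)).2 fun i => ?_
  exact h i x hx y hy x' hx' y' hy'

theorem prodMk {G : Type*} [NormedAddCommGroup G] {g : E → G}
    (hf : QuadLip f S A B) (hg : QuadLip g S A B) : QuadLip (fun x => (f x, g x)) S A B := by
  intro x hx y hy x' hx' y' hy'
  exact max_le (hf x hx y hy x' hx' y' hy') (hg x hx y hy x' hx' y' hy')

end QuadLip

/-! ### Grönwall estimates and four-point bounds for smooth maps. -/

section Analysis

variable {E F : Type*} [NormedAddCommGroup E] [NormedSpace ℝ E]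
  [NormedAddCommGroup F] [NormedSpace ℝ F]

theorem norm_le_mul_exp_of_norm_deriv_le {y y' : ℝ → E} {K ε T : ℝ} (hK : 0 ≤ K) (hε : 0 ≤ ε)
    (hy : ∀ t, HasDerivAt y (y' t) t)
    (hb : ∀ t ∈ Icc 0 T, ‖y' t‖ ≤ K * ‖y t‖ + ε) {t : ℝ} (ht : t ∈ Icc 0 T) :
    ‖y t‖ ≤ (‖y 0‖ + ε * t) * Real.exp (K * t) := by
  have h := norm_le_gronwallBound_of_norm_deriv_right_le (f := y) (f' := y') (δ := ‖y 0‖)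
    (K := K) (ε := ε) (a := 0) (b := T) (fun s _ => (hy s).continuousAt.continuousWithinAt)
    (fun s _ => (hy s).hasDerivWithinAt) le_rfl (fun s hs => hb s ⟨hs.1, hs.2.le⟩) t ht
  rw [sub_zero] at h
  exact h.trans (gronwallBound_le_mul_exp hK hε)

/-- Apply the mean value inequality to the difference of `f` along the segments from `y` to `x` and
from `y'` to `x'`, run at the same parameter. The derivative splits into `f' z` on the difference of
the directions, costing `A`, and `f' z - f' z'` on one direction, costing `B`. -/
theorem QuadLip.of_hasFDerivAt {f : E → F} {S : Set E} {A B : ℝ} {f' : E → E →L[ℝ] F} (hS : Convex ℝ S) (hB : 0 ≤ B)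
    (hf : ∀ x ∈ S, HasFDerivAt f (f' x) x) (hbd : ∀ x ∈ S, ‖f' x‖ ≤ A)
    (hlip : ∀ x ∈ S, ∀ y ∈ S, ‖f' x - f' y‖ ≤ B * ‖x - y‖) : QuadLip f S A B := by
  intro x hx y hy x' hx' y' hy'
  have hmem : ∀ {a b : E}, a ∈ S → b ∈ S → ∀ t ∈ Icc (0 : ℝ) 1, b + t • (a - b) ∈ S := by
    intro a b ha hb t ht
    exact hS.add_smul_sub_mem hb ha ht
  have hd : ∀ {a b : E}, a ∈ S → b ∈ S → ∀ t ∈ Icc (0 : ℝ) 1,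
      HasDerivAt (fun s : ℝ => f (b + s • (a - b))) (f' (b + t • (a - b)) (a - b)) t := by
    intro a b ha hb t ht
    have h1 : HasDerivAt (fun s : ℝ => b + s • (a - b)) (a - b) t := by
      simpa using ((hasDerivAt_id t).smul_const (a - b)).const_add b
    exact (hf _ (hmem ha hb t ht)).comp_hasDerivAt t h1
  have key := norm_image_sub_le_of_norm_deriv_le_segment_01'
    (f := fun s : ℝ => f (y + s • (x - y)) - f (y' + s • (x' - y')))
    (f' := fun t => f' (y + t • (x - y)) (x - y) - f' (y' + t • (x' - y')) (x' - y'))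
    (C := A * ‖x - y - (x' - y')‖ + B * (‖x - x'‖ + ‖y - y'‖) * ‖x' - y'‖)
    (fun t ht => ((hd hx hy t ht).sub (hd hx' hy' t ht)).hasDerivWithinAt) ?_
  · simp only [one_smul, zero_smul, add_zero, add_sub_cancel] at key
    rwa [show f x - f y - (f x' - f y') = f x - f x' - (f y - f y') by abel]
  · intro t ht
    have ht' : t ∈ Icc (0 : ℝ) 1 := ⟨ht.1, ht.2.le⟩
    set z := y + t • (x - y)
    set z' := y' + t • (x' - y')
    have e : f' z (x - y) - f' z' (x' - y') =
        f' z (x - y - (x' - y')) + (f' z - f' z') (x' - y') := by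
      simp only [map_sub, sub_apply]; abel
    rw [e]
    have hz : ‖z - z'‖ ≤ ‖x - x'‖ + ‖y - y'‖ := by
      have : z - z' = t • (x - x') + (1 - t) • (y - y') := by
        simp only [z, z']; module
      rw [this]
      refine (norm_add_le _ _).trans ?_
      rw [norm_smul, norm_smul, Real.norm_of_nonneg ht.1,
        Real.norm_of_nonneg (sub_nonneg.2 ht.2.le)]
      nlinarith [norm_nonneg (x - x'), norm_nonneg (y - y'), ht.1, ht.2]
    refine (norm_add_le _ _).trans (add_le_add ?_ ?_)
    · exact (f' z).le_of_opNorm_le (hbd z (hmem hx hy t ht')) _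
    · refine (f' z - f' z').le_of_opNorm_le ?_ _
      exact (hlip z (hmem hx hy t ht') z' (hmem hx' hy' t ht')).trans
        (mul_le_mul_of_nonneg_left hz hB)

theorem ContDiff.exists_quadLip_closedBall [FiniteDimensional ℝ E] {f : E → F}
    (hf : ContDiff ℝ 2 f) (R : ℝ) :
    ∃ A B : ℝ, 0 ≤ A ∧ 0 ≤ B ∧ QuadLip f (Metric.closedBall 0 R) A B := by
  have hc : IsCompact (Metric.closedBall (0 : E) R) :=
    have := FiniteDimensional.proper ℝ E; isCompact_closedBall _ _
  have hconv := convex_closedBall (0 : E) R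
  have hf1 : ContDiff ℝ 1 (fderiv ℝ f) := hf.fderiv_right (by norm_num)
  obtain ⟨A, hA⟩ := hc.exists_bound_of_continuousOn hf1.continuous.continuousOn
  obtain ⟨B, hB⟩ := hc.exists_bound_of_continuousOn
    (hf1.continuous_fderiv (by norm_num)).continuousOn
  refine ⟨|A|, |B|, abs_nonneg _, abs_nonneg _, QuadLip.of_hasFDerivAt (f' := fderiv ℝ f) hconv
    (abs_nonneg _) (fun x _ => (hf.differentiable (by norm_num) x).hasFDerivAt)
    (fun x hx => (hA x hx).trans (le_abs_self _)) fun x hx y hy => ?_⟩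
  exact hconv.norm_image_sub_le_of_norm_fderiv_le
    (fun z _ => (hf1.differentiable (by norm_num)) z)
    (fun z hz => (hB z hz).trans (le_abs_self _)) hy hx

/-! ### Curves and flows -/

variable {f g : E → E} {S : Set E} {A B T : ℝ}

/-- Stability of solutions of `y' = f y + p`. -/
theorem QuadLip.norm_curve_sub_le (hf : QuadLip f S A B) (hA : 0 ≤ A)
    {κ : ℝ} (hκ : 0 ≤ κ) {x y p q : ℝ → E} (hx : ∀ t, HasDerivAt x (f (x t) + p t) t)
    (hy : ∀ t, HasDerivAt y (f (y t) + q t) t) (hxS : ∀ t ∈ Icc 0 T, x t ∈ S)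
    (hyS : ∀ t ∈ Icc 0 T, y t ∈ S) {μ : ℝ} (hμ : 0 ≤ μ)
    (hpq : ∀ t ∈ Icc 0 T, ‖p t - q t‖ ≤ μ * ‖x t - y t‖ + κ)
    {t : ℝ} (ht : t ∈ Icc 0 T) :
    ‖x t - y t‖ ≤ (‖x 0 - y 0‖ + κ * t) * Real.exp ((A + μ) * t) := by
  refine norm_le_mul_exp_of_norm_deriv_le (y := fun s => x s - y s) (add_nonneg hA hμ) hκ
    (fun s => (hx s).sub (hy s)) (fun s hs => ?_) ht
  rw [show f (x s) + p s - (f (y s) + q s) = (f (x s) - f (y s)) + (p s - q s) by abel]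
  have := hf.norm_sub_le (hxS s hs) (hyS s hs)
  have := hpq s hs
  refine (norm_add_le _ _).trans ?_
  linarith

/-- Grönwall for the four-point difference itself: the `A` term of `QuadLip` is the linear growth
rate, while the `B` term and the perturbation act as a constant source, being bounded by a priori
estimates on the pairwise distances. -/
theorem QuadLip.norm_curve_sub_sub_le (hf : QuadLip f S A B) (hA : 0 ≤ A) (hB : 0 ≤ B)
    {x y x' y' p p' : ℝ → E} (hx : ∀ t, HasDerivAt x (f (x t) + p t) t)
    (hy : ∀ t, HasDerivAt y (f (y t)) t) (hx' : ∀ t, HasDerivAt x' (f (x' t) + p' t) t)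
    (hy' : ∀ t, HasDerivAt y' (f (y' t)) t)
    (hxS : ∀ t ∈ Icc 0 T, x t ∈ S) (hyS : ∀ t ∈ Icc 0 T, y t ∈ S)
    (hxS' : ∀ t ∈ Icc 0 T, x' t ∈ S) (hyS' : ∀ t ∈ Icc 0 T, y' t ∈ S)
    {a b c κ : ℝ} (hκ : 0 ≤ κ) (ha0 : 0 ≤ a) (hc0 : 0 ≤ c)
    (hb0 : 0 ≤ b) (ha : ∀ t ∈ Icc 0 T, ‖x t - x' t‖ ≤ a) (hb : ∀ t ∈ Icc 0 T, ‖y t - y' t‖ ≤ b)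
    (hc : ∀ t ∈ Icc 0 T, ‖x' t - y' t‖ ≤ c) (hp : ∀ t ∈ Icc 0 T, ‖p t - p' t‖ ≤ κ)
    {t : ℝ} (ht : t ∈ Icc 0 T) :
    ‖x t - y t - (x' t - y' t)‖ ≤
      (‖x 0 - y 0 - (x' 0 - y' 0)‖ + (B * (a + b) * c + κ) * t) * Real.exp (A * t) := by
  refine norm_le_mul_exp_of_norm_deriv_le (y := fun s => x s - y s - (x' s - y' s)) hA
    (by positivity) (fun s => ((hx s).sub (hy s)).sub ((hx' s).sub (hy' s)))
    (fun s hs => ?_) ht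
  rw [show f (x s) + p s - f (y s) - (f (x' s) + p' s - f (y' s)) =
    (f (x s) - f (y s) - (f (x' s) - f (y' s))) + (p s - p' s) by abel]
  have h1 := hf _ (hxS s hs) _ (hyS s hs) _ (hxS' s hs) _ (hyS' s hs)
  have h2 : B * (‖x s - x' s‖ + ‖y s - y' s‖) * ‖x' s - y' s‖ ≤ B * (a + b) * c := by
    gcongr
    exacts [ha s hs, hb s hs, hc s hs]
  have := hp s hs
  refine (norm_add_le _ _).trans ?_
  linarith

/-- The flow satisfies a second-order Lipschitz condition if its vector field does. -/
theorem IsFlow.quadLip {φ : ℝ → E → E} (hφ : IsFlow f φ) (hf : QuadLip f S A B) (hA : 0 ≤ A)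
    (hB : 0 ≤ B) {t : ℝ} (ht : t ∈ Icc 0 T) :
    QuadLip (φ t) {z | ∀ s ∈ Icc 0 T, φ s z ∈ S} (Real.exp (A * T))
      (B * T * Real.exp (3 * A * T)) := by
  intro x hx y hy x' hx' y' hy'
  have hT : 0 ≤ T := ht.1.trans ht.2
  have hder : ∀ z s, HasDerivAt (fun s => φ s z) (f (φ s z) + (0 : E)) s := by
    intro z s; simpa using (hφ z).2 s
  have hlip : ∀ {z w : E}, (∀ s ∈ Icc 0 T, φ s z ∈ S) → (∀ s ∈ Icc 0 T, φ s w ∈ S) →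
      ∀ s ∈ Icc 0 T, ‖φ s z - φ s w‖ ≤ ‖z - w‖ * Real.exp (A * T) := by
    intro z w hz hw s hs
    have h := hf.norm_curve_sub_le hA le_rfl (hder z) (hder w) hz hw le_rfl (by simp) hs
    simp only [(hφ z).1, (hφ w).1, zero_mul, add_zero] at h
    refine h.trans ?_
    gcongr
    exact hs.2
  have h := hf.norm_curve_sub_sub_le hA hB (hder x) (hφ y).2 (hder x') (hφ y').2 hx hy hx' hy'
    (κ := 0) le_rfl (by positivity) (by positivity) (by positivity)
    (hlip hx hx') (hlip hy hy') (hlip hx' hy') (by simp) ht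
  simp only [(hφ _).1] at h
  -- Two factors come from the Lipschitz growth of the distances in the `B` term, the third from
  -- Grönwall.
  have e3 : Real.exp (3 * A * T) = Real.exp (A * T) * Real.exp (A * T) * Real.exp (A * T) := by
    rw [← Real.exp_add, ← Real.exp_add]; ring_nf
  calc _ ≤ _ := h
    _ ≤ (‖x - y - (x' - y')‖ + (B * (‖x - x'‖ * Real.exp (A * T) + ‖y - y'‖ * Real.exp (A * T)) *
      (‖x' - y'‖ * Real.exp (A * T)) + 0) * T) * Real.exp (A * T) := by
        gcongr
        · exact ht.2
        · exact ht.2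
    _ = _ := by rw [e3]; ring

/-- Dependence of the flow on a perturbation `g` of the vector field that is small in the
Lipschitz norm. -/
theorem IsFlow.norm_perturbed_sub_le {φ ψ : ℝ → E → E} (hφ : IsFlow f φ)
    (hψ : IsFlow (fun u => f u + g u) ψ) (hf : QuadLip f S A B) (hA : 0 ≤ A) (hB : 0 ≤ B)
    {κ κ₀ : ℝ} (hκ : 0 ≤ κ) (hκ₀ : κ ≤ κ₀) (hg : ∀ u, ‖g u‖ ≤ κ)
    (hg' : ∀ u w, ‖g u - g w‖ ≤ κ * ‖u - w‖) {u w : E}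
    (hφu : ∀ s ∈ Icc 0 T, φ s u ∈ S) (hφw : ∀ s ∈ Icc 0 T, φ s w ∈ S)
    (hψu : ∀ s ∈ Icc 0 T, ψ s u ∈ S) (hψw : ∀ s ∈ Icc 0 T, ψ s w ∈ S)
    {t : ℝ} (ht : t ∈ Icc 0 T) :
    ‖ψ t u - φ t u‖ ≤ κ * t * Real.exp (A * T) ∧
    ‖(ψ t u - φ t u) - (ψ t w - φ t w)‖ ≤ κ * t *
      ((2 * B * T * Real.exp (A * T) + 1) * Real.exp ((A + κ₀) * T) * Real.exp (A * T)) *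
        ‖u - w‖ := by
  have hT : 0 ≤ T := ht.1.trans ht.2
  have hder : ∀ z s, HasDerivAt (fun s => φ s z) (f (φ s z) + (0 : E)) s := by
    intro z s; simpa using (hφ z).2 s
  have hη : ∀ {z : E}, (∀ s ∈ Icc 0 T, φ s z ∈ S) → (∀ s ∈ Icc 0 T, ψ s z ∈ S) →
      ∀ s ∈ Icc 0 T, ‖ψ s z - φ s z‖ ≤ κ * s * Real.exp (A * T) := by
    intro z h1 h2 s hs
    have h := hf.norm_curve_sub_le hA hκ (hψ z).2 (hder z) h2 h1 le_rfl
      (by intro r _; simpa using hg _) hs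
    simp only [(hφ z).1, (hψ z).1, sub_self, norm_zero, zero_add, add_zero] at h
    refine h.trans ?_
    have := hs.1
    gcongr
    exact hs.2
  refine ⟨hη hφu hψu t ht, ?_⟩
  have hl1 : ∀ s ∈ Icc 0 T, ‖φ s u - φ s w‖ ≤ Real.exp ((A + κ₀) * T) * ‖u - w‖ := by
    intro s hs
    have h := hf.norm_curve_sub_le hA le_rfl (hder u) (hder w) hφu hφw le_rfl (by simp) hs
    simp only [(hφ u).1, (hφ w).1, zero_mul, add_zero] at h
    refine h.trans ?_
    rw [mul_comm]
    have := hs.1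
    have h0 : A * s ≤ (A + κ₀) * T := by nlinarith [hs.2, mul_nonneg (hκ.trans hκ₀) hT]
    gcongr
  have hl2 : ∀ s ∈ Icc 0 T, ‖ψ s u - ψ s w‖ ≤ Real.exp ((A + κ₀) * T) * ‖u - w‖ := by
    intro s hs
    have h := hf.norm_curve_sub_le hA le_rfl (hψ u).2 (hψ w).2 hψu hψw hκ
      (by intro r _; simpa using hg' _ _) hs
    simp only [(hψ u).1, (hψ w).1, zero_mul, add_zero] at h
    refine h.trans ?_
    rw [mul_comm]
    have h0 : (A + κ) * s ≤ (A + κ₀) * T :=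
      mul_le_mul (by linarith) hs.2 hs.1 (by linarith)
    gcongr
  -- Both flows start at the same states, so the initial four-point difference vanishes and only the
  -- source terms, all proportional to `κ`, remain. Using `κ₀` in the exponents keeps the constant
  -- independent of `κ`.
  have h := hf.norm_curve_sub_sub_le hA hB (hψ u).2 (hφ u).2 (hψ w).2 (hφ w).2 hψu hφu hψw hφw
    (κ := κ * (Real.exp ((A + κ₀) * T) * ‖u - w‖)) (c := κ * T * Real.exp (A * T))
    (by positivity) (by positivity) (by positivity) (by positivity)
    hl2 hl1 (fun s hs => (hη hφw hψw s hs).trans (by gcongr; exact hs.2))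
    (fun s hs => (hg' _ _).trans (by gcongr; exact hl2 s hs)) ht
  simp only [(hφ _).1, (hψ _).1, sub_self, norm_zero, zero_add] at h
  refine h.trans ?_
  have := ht.1
  have h2 : Real.exp (A * t) ≤ Real.exp (A * T) := by gcongr; exact ht.2
  refine (mul_le_mul_of_nonneg_left h2 (by positivity)).trans (le_of_eq (by ring))

/-- Flows of vector fields that are Lipschitz on balls are one-parameter semigroups. -/
theorem IsFlow.add_apply {φ : ℝ → E → E} (hφ : IsFlow f φ)
    (hf : ∀ R, ∃ A B, 0 ≤ A ∧ 0 ≤ B ∧ QuadLip f (Metric.closedBall 0 R) A B)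
    {s : ℝ} (hs : 0 ≤ s) (t : ℝ) (u : E) : φ (s + t) u = φ s (φ t u) := by
  have hx : ∀ r, HasDerivAt (fun r => φ (r + t) u) (f (φ (r + t) u) + (0 : E)) r := by
    intro r
    simpa using ((hφ u).2 (r + t)).comp_add_const r t
  have hy : ∀ r, HasDerivAt (fun r => φ r (φ t u)) (f (φ r (φ t u)) + (0 : E)) r := by
    intro r
    simpa using (hφ (φ t u)).2 r
  have hbd : ∀ {y : ℝ → E} {y' : ℝ → E}, (∀ r, HasDerivAt y (y' r) r) →
      ∃ R, ∀ r ∈ Icc 0 s, ‖y r‖ ≤ R := fun h =>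
    isCompact_Icc.exists_bound_of_continuousOn
      fun r _ => (h r).continuousAt.continuousWithinAt
  obtain ⟨R₁, h1⟩ := hbd hx
  obtain ⟨R₂, h2⟩ := hbd hy
  -- On `[0, s]` both curves are compact arcs, so uniqueness is only needed inside one ball.
  obtain ⟨A, B, hA, -, hAB⟩ := hf (max R₁ R₂)
  have h := hAB.norm_curve_sub_le hA le_rfl hx hy (T := s)
    (fun r hr => by simpa using Or.inl (h1 r hr)) (fun r hr => by simpa using Or.inr (h2 r hr))
    le_rfl (by simp) ⟨hs, le_rfl⟩
  simp only [(hφ _).1, zero_add, sub_self, norm_zero, zero_mul, add_zero] at h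
  exact sub_eq_zero.1 (norm_le_zero_iff.1 h)

/-- Lipschitz bound for the difference of a flow over `n` steps and `n` steps of a one-step map
whose defect is of size `ρ dt` in the Lipschitz norm. -/
theorem IsFlow.norm_sub_iterate_sub_le {φ : ℝ → E → E} (hφ : IsFlow f φ)
    (hadd : ∀ s, 0 ≤ s → ∀ t u, φ (s + t) u = φ s (φ t u))
    (hf : QuadLip f S A B) (hA : 0 ≤ A) (hB : 0 ≤ B) {D : Set E}
    (hS : ∀ u ∈ D, ∀ t ∈ Icc 0 (2 * T), φ t u ∈ S)
    {dt ρ : ℝ} (hdt : 0 < dt) (hρ : 0 ≤ ρ) {Φ : E → E}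
    (hsize : ∀ u ∈ D, ‖Φ u - φ dt u‖ ≤ ρ * dt)
    (hlip : ∀ u ∈ D, ∀ w ∈ D, ‖(Φ u - φ dt u) - (Φ w - φ dt w)‖ ≤ ρ * dt * ‖u - w‖)
    {n : ℕ} (hn : n * dt ≤ T) {u w : E} (hu : ∀ i < n, Φ^[i] u ∈ D) (hw : ∀ i < n, Φ^[i] w ∈ D) :
    ‖(φ (n * dt) u - Φ^[n] u) - (φ (n * dt) w - Φ^[n] w)‖ ≤
      n * dt * (ρ * Real.exp (2 * T * ρ)) * ((1 + 2 * B * T) * Real.exp (5 * A * T)) *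
        ‖u - w‖ := by
  rcases Nat.eq_zero_or_pos n with rfl | hn0
  · simp [(hφ _).1]
  have hnT : ∀ i : ℕ, i ≤ n → (i : ℝ) * dt ≤ T := fun i hi => le_trans (by gcongr) hn
  have hdtT : dt ≤ T := by simpa using hnT 1 hn0
  have hT : 0 ≤ T := hdt.le.trans hdtT
  set D' : Set E := {z | ∀ s ∈ Icc 0 T, φ s z ∈ S} with hD'
  have hDD' : ∀ a ∈ D, a ∈ D' := fun a ha s hs => hS a ha s ⟨hs.1, by linarith [hs.2]⟩
  -- A trajectory of length `T` started after one step explains the horizon `2 * T` in `hS`.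
  have hφD' : ∀ a ∈ D, φ dt a ∈ D' := fun a ha s hs => by
    rw [← hadd s hs.1]
    exact hS a ha _ ⟨by linarith [hs.1], by linarith [hs.2]⟩
  have hquad : ∀ s ∈ Icc 0 T, QuadLip (φ s) D' _ _ := fun s hs => hφ.quadLip hf hA hB hs
  -- growth of differences under one step of the flow and of the integrator
  have hφdt : ∀ a ∈ D, ∀ b ∈ D, ‖φ dt a - φ dt b‖ ≤ Real.exp (A * dt) * ‖a - b‖ := by
    intro a ha b hb
    have hder : ∀ z s, HasDerivAt (fun s => φ s z) (f (φ s z) + (0 : E)) s := by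
      intro z s; simpa using (hφ z).2 s
    have h := hf.norm_curve_sub_le hA le_rfl (hder a) (hder b) (hDD' a ha) (hDD' b hb) le_rfl
      (by simp) ⟨hdt.le, hdtT⟩
    simpa [(hφ _).1, mul_comm] using h
  have hexp : Real.exp (A * dt) + ρ * dt ≤ Real.exp ((A + ρ) * dt) := by
    rw [add_mul, Real.exp_add]
    have h1 := Real.add_one_le_exp (ρ * dt)
    have h2 : 1 ≤ Real.exp (A * dt) := Real.one_le_exp (by positivity)
    nlinarith [mul_nonneg hρ hdt.le]
  have hΦ : ∀ a ∈ D, ∀ b ∈ D, ‖Φ a - Φ b‖ ≤ Real.exp ((A + ρ) * dt) * ‖a - b‖ := by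
    intro a ha b hb
    have e : Φ a - Φ b = (φ dt a - φ dt b) + ((Φ a - φ dt a) - (Φ b - φ dt b)) := by abel
    rw [e]
    refine (norm_add_le _ _).trans ((add_le_add (hφdt a ha b hb) (hlip a ha b hb)).trans ?_)
    rw [← add_mul]
    gcongr
  have hiter : ∀ i : ℕ, i < n →
      ‖Φ^[i] u - Φ^[i] w‖ ≤ Real.exp ((A + ρ) * (i * dt)) * ‖u - w‖ := by
    intro i
    induction i with
    | zero => simp
    | succ i ih =>
      intro hi
      have hi' : i < n := by omega
      rw [Function.iterate_succ_apply', Function.iterate_succ_apply']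
      refine (hΦ _ (hu i hi') _ (hw i hi')).trans ?_
      refine (mul_le_mul_of_nonneg_left (ih hi') (Real.exp_pos _).le).trans (le_of_eq ?_)
      rw [← mul_assoc, ← Real.exp_add]
      push_cast; ring_nf
  set X := Real.exp ((A + ρ) * T) with hX
  have hX1 : 1 ≤ X := Real.one_le_exp (by positivity)
  have hAρ : 0 ≤ A + ρ := by positivity
  have hiter' : ∀ i < n, ‖Φ^[i] u - Φ^[i] w‖ ≤ X * ‖u - w‖ := fun i hi =>
    (hiter i hi).trans (mul_le_mul_of_nonneg_right (Real.exp_le_exp.2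
      (mul_le_mul_of_nonneg_left (hnT i hi.le) hAρ)) (norm_nonneg _))
  -- one summand of the telescoping sum
  set Y := Real.exp (3 * A * T) with hY
  have hY1 : 1 ≤ Y := Real.one_le_exp (by positivity)
  -- The first `i` steps are taken with the integrator and the remaining `n - i` with the exact
  -- flow; `h 0` and `h n` are the two differences to be compared.
  set h : ℕ → E := fun i => (φ ((n - i : ℕ) * dt) (Φ^[i] u)) - (φ ((n - i : ℕ) * dt) (Φ^[i] w))
    with hh
  have hterm : ∀ i ∈ Finset.range n, ‖h i - h (i + 1)‖ ≤
      dt * (ρ * Real.exp (2 * T * ρ)) * ((1 + 2 * B * T) * Real.exp (5 * A * T)) * ‖u - w‖ := by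
    intro i hi
    have hi : i < n := Finset.mem_range.1 hi
    set a := Φ^[i] u with ha
    set b := Φ^[i] w with hb
    have haD : a ∈ D := hu i hi
    have hbD : b ∈ D := hw i hi
    set s : ℝ := ((n - (i + 1) : ℕ) : ℝ) * dt with hs
    have hs0 : s ∈ Icc 0 T := ⟨by positivity, hnT _ (by omega)⟩
    have hstep : ((n - i : ℕ) : ℝ) * dt = s + dt := by
      rw [show n - i = (n - (i + 1)) + 1 by omega]
      push_cast; ring
    have hhi : h i = φ s (φ dt a) - φ s (φ dt b) := by
      simp only [hh, hstep, hadd s hs0.1, ha, hb]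
    have hhi' : h (i + 1) = φ s (Φ a) - φ s (Φ b) := by
      simp only [hh, ha, hb, Function.iterate_succ_apply', hs]
    have hr1 : ‖φ dt a - Φ a - (φ dt b - Φ b)‖ ≤ ρ * dt * ‖a - b‖ := by
      rw [← norm_neg, show -(φ dt a - Φ a - (φ dt b - Φ b)) =
        (Φ a - φ dt a) - (Φ b - φ dt b) by abel]
      exact hlip a haD b hbD
    have hab := hiter' i hi
    -- One factor `X` comes from comparing the one-step images of `a` and `b`, the other from `‖a -
    -- b‖ ≤ X * ‖u - w‖`; hence the exponents 5 = 3 + 2 on `A * T` and 2 on `T * ρ`.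
    have hfin : (1 + 2 * B * T) * Y * X * X * ρ =
        ρ * Real.exp (2 * T * ρ) * ((1 + 2 * B * T) * Real.exp (5 * A * T)) := by
      have : Y * X * X = Real.exp (2 * T * ρ) * Real.exp (5 * A * T) := by
        rw [hY, hX, ← Real.exp_add, ← Real.exp_add, ← Real.exp_add]; ring_nf
      linear_combination (1 + 2 * B * T) * ρ * this
    have hgoal : ‖h i - h (i + 1)‖ ≤ (1 + 2 * B * T) * Y * X * ρ * dt * ‖a - b‖ := by
      have e : h i - h (i + 1) = φ s (φ dt a) - φ s (Φ a) - (φ s (φ dt b) - φ s (Φ b)) := by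
        rw [hhi, hhi']; exact sub_sub_sub_comm _ _ _ _
      rw [e]
      -- The final state `Φ^[n] u` need not lie in `D`. It occurs only in the last summand, where `s
      -- = 0` and no transport takes place.
      rcases Nat.lt_or_ge (i + 1) n with hlt | hge
      · have hΦa : Φ a ∈ D := by
          simpa only [ha, ← Function.iterate_succ_apply'] using hu (i + 1) hlt
        have hΦb : Φ b ∈ D := by
          simpa only [hb, ← Function.iterate_succ_apply'] using hw (i + 1) hlt
        refine (hquad s hs0 _ (hφD' a haD) _ (hDD' _ hΦa) _ (hφD' b hbD) _ (hDD' _ hΦb)).trans ?_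
        have h1 : ‖φ dt a - φ dt b‖ ≤ X * ‖a - b‖ := by
          refine (hφdt a haD b hbD).trans ?_
          rw [hX]
          gcongr
          linarith
        have h2 : ‖Φ a - Φ b‖ ≤ X * ‖a - b‖ := by
          refine (hΦ a haD b hbD).trans ?_
          rw [hX]
          gcongr
        have h3 : ‖φ dt b - Φ b‖ ≤ ρ * dt := by
          rw [norm_sub_rev]; exact hsize b hbD
        have h4 : Real.exp (A * T) ≤ Y * X := by
          have : Real.exp (A * T) ≤ Y := by
            rw [hY]; gcongr; nlinarith
          nlinarith
        calc _ ≤ (Y * X) * (ρ * dt * ‖a - b‖) +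
              B * T * Y * (X * ‖a - b‖ + X * ‖a - b‖) * (ρ * dt) := by gcongr
          _ = _ := by ring
      · have hs00 : s = 0 := by
          rw [hs, show n - (i + 1) = 0 by omega]; simp
        rw [hs00]
        simp only [(hφ _).1]
        refine hr1.trans ?_
        have : 1 ≤ (1 + 2 * B * T) * Y * X := by
          have h5 : 1 ≤ 1 + 2 * B * T := by
            have : 0 ≤ 2 * B * T := by positivity
            linarith
          exact one_le_mul_of_one_le_of_one_le (one_le_mul_of_one_le_of_one_le h5 hY1) hX1
        calc ρ * dt * ‖a - b‖ = 1 * (ρ * dt * ‖a - b‖) := by ring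
          _ ≤ (1 + 2 * B * T) * Y * X * (ρ * dt * ‖a - b‖) := by gcongr
          _ = _ := by ring
    calc ‖h i - h (i + 1)‖ ≤ (1 + 2 * B * T) * Y * X * ρ * dt * ‖a - b‖ := hgoal
      _ ≤ (1 + 2 * B * T) * Y * X * ρ * dt * (X * ‖u - w‖) := by gcongr
      _ = ((1 + 2 * B * T) * Y * X * X * ρ) * dt * ‖u - w‖ := by ring
      _ = _ := by rw [hfin]; ring
  have htel : (φ (n * dt) u - Φ^[n] u) - (φ (n * dt) w - Φ^[n] w) =
      ∑ i ∈ Finset.range n, (h i - h (i + 1)) := by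
    rw [Finset.sum_range_sub']
    simp only [hh, Nat.sub_zero, Nat.sub_self, Nat.cast_zero, zero_mul, (hφ _).1,
      Function.iterate_zero, id]
    abel
  rw [htel]
  refine (norm_sum_le_of_le _ hterm).trans (le_of_eq ?_)
  rw [Finset.sum_const, Finset.card_range, nsmul_eq_mul]
  ring

end Analysis

/-! ### The parareal recursion -/

theorem prod_Icc_sub_div_factorial (n k : ℕ) :
    (∏ j ∈ Finset.Icc 1 k, ((n : ℝ) + 1 - (j : ℝ))) / (k.factorial : ℝ) = n.choose k := by
  have hk : (k.factorial : ℝ) ≠ 0 := by positivity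
  rw [div_eq_iff hk]
  induction k with
  | zero => simp
  | succ k ih =>
    rw [Finset.prod_Icc_succ_top (by omega), ih (by positivity), Nat.factorial_succ]
    have h := Nat.choose_succ_right_eq n k
    rcases Nat.lt_or_ge n k with hlt | hge
    -- For `k > n` the product has a zero factor and the binomial coefficient vanishes too.
    · simp [Nat.choose_eq_zero_of_lt hlt, Nat.choose_eq_zero_of_lt (Nat.lt_succ_of_lt hlt)]
    · have h' : (n.choose (k + 1) : ℝ) * (k + 1) = n.choose k * ((n : ℝ) - k) := by
        rw [← Nat.cast_sub hge]; exact_mod_cast h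
      push_cast
      linear_combination -(k.factorial : ℝ) * h'

/-- Induction on `n` with Pascal's rule: the `α` term supplies `n.choose k`, the `M` term `n.choose
(k + 1)`, and both carry the same power of `M`. Where the exponent `n - k` is negative, the binomial
coefficient is zero. -/
theorem le_of_parareal_recursion {e : ℕ → ℕ → ℝ} {α M δ : ℝ} {N : ℕ} (hα : 0 ≤ α) (hM : 1 ≤ M)
    (hδ : 0 ≤ δ) (h0 : ∀ k, e k 0 = 0) (hinit : ∀ n < N, e 0 (n + 1) ≤ δ)
    (hrec : ∀ k, ∀ n < N, e (k + 1) (n + 1) ≤ α * e k n + M * e (k + 1) n)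
    (k n : ℕ) (hn : n < N) :
    e k (n + 1) ≤ M ^ ((n : ℤ) - (k : ℤ)) * (α ^ k / (k.factorial : ℝ)) *
      (∏ j ∈ Finset.Icc 1 k, ((n : ℝ) + 1 - (j : ℝ))) * δ := by
  have hM0 : 0 < M := by linarith
  have key : ∀ n < N, ∀ k, e k (n + 1) ≤ M ^ ((n : ℤ) - (k : ℤ)) * α ^ k * n.choose k * δ := by
    intro n
    induction n with
    | zero =>
      intro hn k
      cases k with
      | zero => simpa using hinit 0 hn
      | succ k =>
        have := hrec k 0 hn
        simpa [h0] using this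
    | succ n ih =>
      intro hn k
      have ih := ih (by omega)
      cases k with
      | zero =>
        refine (hinit _ hn).trans ?_
        simp only [Nat.cast_zero, sub_zero, pow_zero, mul_one, Nat.choose_zero_right,
          Nat.cast_one, zpow_natCast]
        exact le_mul_of_one_le_left hδ (one_le_pow₀ hM)
      | succ k =>
        refine (hrec k (n + 1) hn).trans ?_
        have h1 := mul_le_mul_of_nonneg_left (ih k) hα
        have h2 := mul_le_mul_of_nonneg_left (ih (k + 1)) hM0.le
        refine (add_le_add h1 h2).trans (le_of_eq ?_)
        have e1 : M ^ (((n + 1 : ℕ) : ℤ) - ((k + 1 : ℕ) : ℤ)) = M ^ ((n : ℤ) - (k : ℤ)) := by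
          congr 1; push_cast; ring
        have e2 : M * M ^ ((n : ℤ) - ((k + 1 : ℕ) : ℤ)) = M ^ ((n : ℤ) - (k : ℤ)) := by
          rw [← zpow_one_add₀ hM0.ne']; congr 1; push_cast; ring
        rw [e1, Nat.choose_succ_succ, ← e2]
        push_cast
        ring
  refine (key n hn k).trans (le_of_eq ?_)
  rw [← prod_Icc_sub_div_factorial n k]
  ring

/-- Separates the contributions of two defects to the parareal contraction factor. -/
theorem add_mul_exp_le {a b t : ℝ} (ha : 0 ≤ a) (hb : 0 ≤ b) (ht : 0 ≤ t) :
    (a + b) * Real.exp (t * (a + b)) ≤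
      2 * a * Real.exp (2 * t * a) + 2 * b * Real.exp (2 * t * b) := by
  -- Taking `c` to be the larger of the two defects bounds the coupled exponential by a term in that
  -- defect alone.
  have key : ∀ {c : ℝ}, 0 ≤ c → a + b ≤ 2 * c →
      (a + b) * Real.exp (t * (a + b)) ≤ 2 * c * Real.exp (2 * t * c) := by
    intro c hc h
    have h1 : t * (a + b) ≤ 2 * t * c := by nlinarith
    gcongr
  have ha' : 0 ≤ 2 * a * Real.exp (2 * t * a) := by positivity
  have hb' : 0 ≤ 2 * b * Real.exp (2 * t * b) := by positivity
  rcases le_total a b with h | h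
  · linarith [key hb (by linarith)]
  · linarith [key ha (by linarith)]

/-- `f` satisfies a second-order Lipschitz condition on `S` with some constants. -/
def HasQuadLip {E F : Type*} [NormedAddCommGroup E] [NormedAddCommGroup F]
    (f : E → F) (S : Set E) : Prop :=
  ∃ A B : ℝ, 0 ≤ A ∧ 0 ≤ B ∧ QuadLip f S A B

/-! ### Second-order Lipschitz conditions with unspecified constants. -/

namespace HasQuadLip

variable {E F : Type*} [NormedAddCommGroup E] [NormedAddCommGroup F]
  {f g : E → F} {S : Set E}

theorem add (hf : HasQuadLip f S) (hg : HasQuadLip g S) :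
    HasQuadLip (fun x => f x + g x) S := by
  obtain ⟨A, B, hA, hB, h⟩ := hf
  obtain ⟨A', B', hA', hB', h'⟩ := hg
  exact ⟨_, _, add_nonneg hA hA', add_nonneg hB hB', h.add h'⟩

theorem sum {ι : Type*} (s : Finset ι) {f : ι → E → F} (h : ∀ i, HasQuadLip (f i) S) :
    HasQuadLip (fun x => ∑ i ∈ s, f i x) S := by
  choose A B hA hB h using h
  exact ⟨_, _, Finset.sum_nonneg fun i _ => hA i, Finset.sum_nonneg fun i _ => hB i,
    QuadLip.sum s fun i _ => h i⟩

theorem clm_comp {G : Type*} [NormedSpace ℝ F] [NormedAddCommGroup G] [NormedSpace ℝ G]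
    (l : F →L[ℝ] G) (h : HasQuadLip f S) : HasQuadLip (fun x => l (f x)) S := by
  obtain ⟨A, B, hA, hB, h⟩ := h
  exact ⟨_, _, by positivity, by positivity, h.clm_comp l⟩

theorem clm [NormedSpace ℝ E] [NormedSpace ℝ F] (l : E →L[ℝ] F) :
    HasQuadLip (fun x => l x) S :=
  ⟨_, _, norm_nonneg _, le_rfl, QuadLip.clm l⟩

theorem comp_clm {G : Type*} [NormedSpace ℝ E] [NormedAddCommGroup G] [NormedSpace ℝ G]
    (l : G →L[ℝ] E) (h : HasQuadLip f univ) {S' : Set G} : HasQuadLip (fun x => f (l x)) S' := by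
  obtain ⟨A, B, hA, hB, h⟩ := h
  exact ⟨_, _, by positivity, by positivity, h.comp_clm l hA hB (mapsTo_univ _ _)⟩

theorem pi {ι : Type*} [Fintype ι] {F : ι → Type*} [∀ i, NormedAddCommGroup (F i)]
    {f : E → ∀ i, F i} (h : ∀ i, HasQuadLip (fun x => f x i) S) : HasQuadLip f S := by
  choose A B hA hB h using h
  exact ⟨∑ i, A i, ∑ i, B i, Finset.sum_nonneg fun i _ => hA i, Finset.sum_nonneg fun i _ => hB i,
    QuadLip.pi (Finset.sum_nonneg fun i _ => hA i) (Finset.sum_nonneg fun i _ => hB i) fun i =>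
      (h i).mono (Finset.single_le_sum (fun i _ => hA i) (Finset.mem_univ i))
        (Finset.single_le_sum (fun i _ => hB i) (Finset.mem_univ i))⟩

theorem prodMk {G : Type*} [NormedAddCommGroup G] {g : E → G}
    (hf : HasQuadLip f S) (hg : HasQuadLip g S) : HasQuadLip (fun x => (f x, g x)) S := by
  obtain ⟨A, B, hA, hB, h⟩ := hf
  obtain ⟨A', B', hA', hB', h'⟩ := hg
  exact ⟨max A A', max B B', le_max_of_le_left hA, le_max_of_le_left hB,
    (h.mono (le_max_left _ _) (le_max_left _ _)).prodMk
      (h'.mono (le_max_right _ _) (le_max_right _ _))⟩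

end HasQuadLip

theorem norm_cexp_I_sub_le (s t : ℝ) :
    ‖Complex.exp (Complex.I * s) - Complex.exp (Complex.I * t)‖ ≤ |s - t| := by
  have e : Complex.exp (Complex.I * s) - Complex.exp (Complex.I * t) =
      Complex.exp (Complex.I * t) * (Complex.exp (Complex.I * ((s - t : ℝ) : ℂ)) - 1) := by
    rw [mul_sub, ← Complex.exp_add, mul_one]
    congr 2
    push_cast; ring
  rw [e, norm_mul, mul_comm Complex.I, Complex.norm_exp_ofReal_mul_I, one_mul]
  exact Real.norm_exp_I_mul_ofReal_sub_one_le

theorem hasQuadLip_cexp_I :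
    HasQuadLip (fun t : ℝ => Complex.exp (Complex.I * t)) univ := by
  have hnorm : ∀ z : ℂ, ‖(ContinuousLinearMap.toSpanSingleton ℝ z)‖ = ‖z‖ := fun z =>
    ContinuousLinearMap.norm_toSpanSingleton z
  refine ⟨1, 1, zero_le_one, zero_le_one, QuadLip.of_hasFDerivAt
    (f' := fun t => ContinuousLinearMap.toSpanSingleton ℝ
      (Complex.exp (Complex.I * t) * Complex.I)) convex_univ zero_le_one ?_ ?_ ?_⟩
  · intro t _
    have h : HasDerivAt (fun t : ℝ => Complex.I * (t : ℂ)) Complex.I t := by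
      simpa using (Complex.ofRealCLM.hasDerivAt (x := t)).const_mul Complex.I
    exact h.cexp.hasFDerivAt
  · intro t _
    rw [hnorm, norm_mul, mul_comm Complex.I, Complex.norm_exp_ofReal_mul_I]
    simp
  · intro s _ t _
    have e : ∀ z w : ℂ, ContinuousLinearMap.toSpanSingleton ℝ z -
        ContinuousLinearMap.toSpanSingleton ℝ w =
          ContinuousLinearMap.toSpanSingleton ℝ (z - w) := fun z w => by
      ext; simp
    rw [e, hnorm, ← sub_mul, norm_mul, Complex.norm_I,
      mul_one, one_mul]
    exact norm_cexp_I_sub_le s t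

/-! ### The electric field -/

theorem norm_fourierExp (L : ℝ) (κ : Fin 3 → ℤ) (x : Vec3) : ‖fourierExp L κ x‖ = 1 := by
  rw [fourierExp, neg_mul, mul_comm, ← neg_mul, ← Complex.ofReal_neg,
    Complex.norm_exp_ofReal_mul_I]

theorem fourierExp_eq (L : ℝ) (κ : Fin 3 → ℤ) (x : Vec3) :
    fourierExp L κ x = Complex.exp (Complex.I * ((-(waveVector L κ ⬝ᵥ x) : ℝ) : ℂ)) := by
  rw [fourierExp]; congr 1; push_cast; ring

theorem abs_dotProduct_le {n : Type*} [Fintype n] (k x : n → ℝ) :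
    |k ⬝ᵥ x| ≤ (∑ a, |k a|) * ‖x‖ := by
  rw [dotProduct, Finset.sum_mul]
  refine (Finset.abs_sum_le_sum_abs _ _).trans (Finset.sum_le_sum fun a _ => ?_)
  rw [abs_mul]
  exact mul_le_mul_of_nonneg_left (norm_le_pi_norm x a) (abs_nonneg _)

theorem norm_fourierExp_sub_le (L : ℝ) (κ : Fin 3 → ℤ) (x y : Vec3) :
    ‖fourierExp L κ x - fourierExp L κ y‖ ≤ (∑ a, |waveVector L κ a|) * ‖x - y‖ := by
  rw [fourierExp_eq, fourierExp_eq]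
  refine (norm_cexp_I_sub_le _ _).trans ?_
  rw [neg_sub_neg, ← dotProduct_sub, norm_sub_rev]
  exact abs_dotProduct_le _ _

namespace PIFModel

variable (𝓜 : PIFModel) {Np : ℕ}

/-- Coefficient of mode `l` in component `a` of the electric field of one particle. -/
noncomputable def fieldCoeff (a : Fin 3) (l : 𝓜.modes) : ℂ :=
  (((Real.sqrt (𝓜.L ^ 3))⁻¹ : ℝ) : ℂ) ^ 2 * (star (𝓜.shapeCoeff l) * 𝓜.shapeCoeff l) *
    (-Complex.I * ((waveVector 𝓜.L l a / (waveVector 𝓜.L l ⬝ᵥ waveVector 𝓜.L l) : ℝ) : ℂ)) *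
    𝓜.charge

/-- Exhibits the field as a quadratic expression in the exponentials with fixed coefficients, the
common form for exact and approximate transforms. -/
theorem electricField_scatter (A : Matrix 𝓜.modes (Fin Np) ℂ) (j : Fin Np) (a : Fin 3) :
    𝓜.electricField (𝓜.scatter A) j a =
      (∑ i : Fin Np, ∑ l : 𝓜.modes, 𝓜.fieldCoeff a l * (star (A l j) * A l i)).re := by
  rw [electricField]
  congr 1
  rw [Matrix.mulVec, dotProduct]
  refine Finset.sum_congr rfl fun i _ => ?_
  rw [Matrix.mul_apply, Finset.sum_mul]
  refine Finset.sum_congr rfl fun l _ => ?_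
  rw [fieldSolve, Matrix.mul_diagonal]
  simp only [scatter, Matrix.conjTranspose_apply, Matrix.smul_apply, Matrix.diagonal_mul,
    smul_eq_mul, star_mul', fieldCoeff, Complex.star_def, Complex.conj_ofReal]
  ring

/-- Sum of the absolute values of all coefficients in the electric field. -/
noncomputable def fieldConst (Np : ℕ) : ℝ := ∑ a : Fin 3, ∑ _i : Fin Np, ∑ l : 𝓜.modes, ‖𝓜.fieldCoeff a l‖

theorem fieldConst_nonneg : 0 ≤ 𝓜.fieldConst Np := by
  unfold fieldConst; positivity

theorem abs_re_sum_fieldCoeff_le (a : Fin 3) {z : Fin Np → 𝓜.modes → ℂ} {b : ℝ} (hb : 0 ≤ b)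
    (hz : ∀ i l, ‖z i l‖ ≤ b) :
    |(∑ i : Fin Np, ∑ l : 𝓜.modes, 𝓜.fieldCoeff a l * z i l).re| ≤ 𝓜.fieldConst Np * b := by
  refine (Complex.abs_re_le_norm _).trans ?_
  have h1 : ‖∑ i : Fin Np, ∑ l : 𝓜.modes, 𝓜.fieldCoeff a l * z i l‖ ≤
      ∑ i : Fin Np, ∑ l : 𝓜.modes, ‖𝓜.fieldCoeff a l‖ * b := by
    refine norm_sum_le_of_le _ fun i _ => norm_sum_le_of_le _ fun l _ => ?_
    rw [norm_mul]
    exact mul_le_mul_of_nonneg_left (hz i l) (norm_nonneg _)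
  refine h1.trans ?_
  simp only [← Finset.sum_mul]
  refine mul_le_mul_of_nonneg_right ?_ hb
  exact Finset.single_le_sum (f := fun a => ∑ _i : Fin Np, ∑ l : 𝓜.modes, ‖𝓜.fieldCoeff a l‖)
    (fun a _ => by positivity) (Finset.mem_univ a)

theorem norm_electricField_nudft_le (x : Fin Np → Vec3) (j : Fin Np) :
    ‖𝓜.electricField (𝓜.scatter (𝓜.nudft x)) j‖ ≤ 𝓜.fieldConst Np := by
  refine (pi_norm_le_iff_of_nonneg 𝓜.fieldConst_nonneg).2 fun a => ?_
  rw [electricField_scatter, Real.norm_eq_abs]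
  refine (𝓜.abs_re_sum_fieldCoeff_le a zero_le_one fun i l => ?_).trans (mul_one _).le
  simp [nudft, norm_fourierExp]

/-- The phase difference of the mode `κ` at particles `j` and `i`. -/
noncomputable def phaseDiff (κ : Fin 3 → ℤ) (j i : Fin Np) : Phase Np →L[ℝ] ℝ :=
  LinearMap.toContinuousLinearMap
    { toFun := fun u => waveVector 𝓜.L κ ⬝ᵥ u.1 j - waveVector 𝓜.L κ ⬝ᵥ u.1 i
      map_add' := fun u w => by simp [dotProduct_add]; ring
      map_smul' := fun r u => by simp [dotProduct_smul]; ring }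

/-- Each product of exact exponentials is `exp (i θ)` with `θ` linear in the state, so the bounds on
the exponential hold on all of phase space. -/
theorem hasQuadLip_electricField (j : Fin Np) (S : Set (Phase Np)) :
    HasQuadLip (fun u : Phase Np => 𝓜.electricField (𝓜.scatter (𝓜.nudft u.1)) j) S := by
  refine HasQuadLip.pi fun a => ?_
  have e : (fun u : Phase Np => 𝓜.electricField (𝓜.scatter (𝓜.nudft u.1)) j a) = fun u =>
      ∑ i : Fin Np, ∑ l : 𝓜.modes,
        (Complex.reCLM.comp (ContinuousLinearMap.mul ℝ ℂ (𝓜.fieldCoeff a l)))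
          (Complex.exp (Complex.I * (𝓜.phaseDiff l j i u : ℝ))) := by
    funext u
    rw [electricField_scatter, Complex.re_sum]
    refine Finset.sum_congr rfl fun i _ => ?_
    rw [Complex.re_sum]
    refine Finset.sum_congr rfl fun l _ => ?_
    simp only [nudft, Matrix.of_apply, fourierExp_eq, ContinuousLinearMap.comp_apply,
      Complex.reCLM_apply, ContinuousLinearMap.mul_apply', Complex.star_def]
    rw [← Complex.exp_conj, ← Complex.exp_add, map_mul, Complex.conj_I, Complex.conj_ofReal]
    congr 3
    simp [phaseDiff]
    ring
  rw [e]
  exact HasQuadLip.sum _ fun i => HasQuadLip.sum _ fun l =>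
    (hasQuadLip_cexp_I.comp_clm (𝓜.phaseDiff l j i)).clm_comp _

/-! ### The vector field -/

theorem hasQuadLip_rhs_nudft {S : Set (Phase Np)}
    (hB : ∀ j, HasQuadLip (fun u : Phase Np => crossProduct (u.2 j) (𝓜.Bext (u.1 j))) S) :
    HasQuadLip (𝓜.rhs (Np := Np) 𝓜.nudft) S := by
  refine HasQuadLip.prodMk (HasQuadLip.clm (ContinuousLinearMap.snd ℝ (Fin Np → Vec3) (Fin Np → Vec3)))
    (HasQuadLip.pi fun j => ?_)
  exact ((𝓜.hasQuadLip_electricField j S).add (hB j)).clm_comp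
    ((𝓜.charge / 𝓜.mass) • ContinuousLinearMap.id ℝ Vec3)

/-- A constant magnetic field makes the force linear in the velocity, so no restriction to bounded
sets is needed. -/
theorem hasQuadLip_rhs_nudft_of_const {B₀ : Vec3} (hB : ∀ x, 𝓜.Bext x = B₀)
    (S : Set (Phase Np)) : HasQuadLip (𝓜.rhs (Np := Np) 𝓜.nudft) S := by
  refine 𝓜.hasQuadLip_rhs_nudft fun j => ?_
  simp only [hB]
  exact HasQuadLip.clm (LinearMap.toContinuousLinearMap
    ({ toFun := fun u => crossProduct (u.2 j) B₀
       map_add' := fun u w => by simp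
       map_smul' := fun r u => by simp } : Phase Np →ₗ[ℝ] Vec3))

theorem hasQuadLip_rhs_nudft_closedBall (R : ℝ) :
    HasQuadLip (𝓜.rhs (Np := Np) 𝓜.nudft) (Metric.closedBall 0 R) := by
  refine 𝓜.hasQuadLip_rhs_nudft fun j => ContDiff.exists_quadLip_closedBall ?_ R
  have hv : ∀ a, ContDiff ℝ 2 fun u : Phase Np => u.2 j a := fun a => by fun_prop
  have hx : ContDiff ℝ 2 fun u : Phase Np => 𝓜.Bext (u.1 j) :=
    𝓜.Bext_contDiff.comp (by fun_prop)
  have hx' := contDiff_pi.1 hx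
  refine contDiff_pi.2 fun a => ?_
  simp only [cross_apply]
  fin_cases a
  · exact ((hv 1).mul (hx' 2)).sub ((hv 2).mul (hx' 1))
  · exact ((hv 2).mul (hx' 0)).sub ((hv 0).mul (hx' 2))
  · exact ((hv 0).mul (hx' 1)).sub ((hv 1).mul (hx' 0))

/-! ### The perturbation caused by the NUFFT -/

/-- Difference of the right-hand sides with NUFFT and with NUDFT. -/
noncomputable def rhsError (𝓝 : NUFFT 𝓜.L) (u : Phase Np) : Phase Np :=
  𝓜.rhs (𝓜.nufft 𝓝) u - 𝓜.rhs 𝓜.nudft u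

theorem rhsError_fst (𝓝 : NUFFT 𝓜.L) (u : Phase Np) : (𝓜.rhsError 𝓝 u).1 = 0 := by
  simp [rhsError, rhs]

theorem rhsError_snd (𝓝 : NUFFT 𝓜.L) (u : Phase Np) (j : Fin Np) (a : Fin 3) :
    (𝓜.rhsError 𝓝 u).2 j a = 𝓜.charge / 𝓜.mass * (∑ i : Fin Np, ∑ l : 𝓜.modes,
      𝓜.fieldCoeff a l * (star (𝓜.nufft 𝓝 u.1 l j) * 𝓜.nufft 𝓝 u.1 l i -
        star (𝓜.nudft u.1 l j) * 𝓜.nudft u.1 l i)).re := by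
  simp only [rhsError, rhs, mul_sub, Finset.sum_sub_distrib, Complex.sub_re,
    ← electricField_scatter]
  simp

theorem norm_prod_error_le {a b p q : ℂ} {η : ℝ} (ha : ‖a‖ ≤ 1)
    (hb : ‖b‖ ≤ 1) (hp : ‖p - a‖ ≤ η) (hq : ‖q - b‖ ≤ η) :
    ‖star p * q - star a * b‖ ≤ η * (2 + η) := by
  have hη : 0 ≤ η := (norm_nonneg _).trans hp
  have e : star p * q - star a * b =
      star (p - a) * b + star a * (q - b) + star (p - a) * (q - b) := by
    rw [star_sub]; ring
  rw [e]
  calc _ ≤ ‖star (p - a)‖ * ‖b‖ + ‖star a‖ * ‖q - b‖ + ‖star (p - a)‖ * ‖q - b‖ := by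
        simp only [← norm_mul]; exact norm_add₃_le
    _ ≤ η * 1 + 1 * η + η * η := by
        simp only [norm_star]; gcongr
    _ = _ := by ring

/-- Expanding around the exact factors leaves six products, each containing at least one
approximation error or a difference of such errors; hence the overall factor `η * d`. -/
theorem norm_prod_error_sub_le {a b p q a' b' p' q' : ℂ} {η d k : ℝ}
    (hd : 0 ≤ d) (hk : 0 ≤ k)
    (hb : ‖b‖ ≤ 1) (ha' : ‖a'‖ ≤ 1)
    (hq : ‖q - b‖ ≤ η) (hp' : ‖p' - a'‖ ≤ η)
    (haa : ‖a - a'‖ ≤ k * d) (hbb : ‖b - b'‖ ≤ k * d)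
    (hpp : ‖(p - a) - (p' - a')‖ ≤ η * d) (hqq : ‖(q - b) - (q' - b')‖ ≤ η * d) :
    ‖(star p * q - star a * b) - (star p' * q' - star a' * b')‖ ≤ η * (2 + 2 * k + 2 * η) * d := by
  have hη : 0 ≤ η := (norm_nonneg _).trans hq
  have e : (star p * q - star a * b) - (star p' * q' - star a' * b') =
      (star ((p - a) - (p' - a')) * b + star (p' - a') * (b - b') + star (a - a') * (q - b)) +
      (star a' * ((q - b) - (q' - b')) + star ((p - a) - (p' - a')) * (q - b) +
        star (p' - a') * ((q - b) - (q' - b'))) := by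
    simp only [star_sub]; ring
  rw [e]
  have h1 : ‖star ((p - a) - (p' - a')) * b + star (p' - a') * (b - b') +
      star (a - a') * (q - b)‖ ≤ η * d * 1 + η * (k * d) + k * d * η := by
    refine norm_add₃_le.trans ?_
    simp only [norm_mul, norm_star]
    gcongr
  have h2 : ‖star a' * ((q - b) - (q' - b')) + star ((p - a) - (p' - a')) * (q - b) +
        star (p' - a') * ((q - b) - (q' - b'))‖ ≤ 1 * (η * d) + η * d * η + η * (η * d) := by
    refine norm_add₃_le.trans ?_
    simp only [norm_mul, norm_star]
    gcongr
  refine (norm_add_le _ _).trans ((add_le_add h1 h2).trans (le_of_eq (by ring)))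

theorem exists_rhsError_bound (Np : ℕ) (c : ℝ) : ∃ K : ℝ, 0 ≤ K ∧
    ∀ (ε : ℝ) (_ : 0 < ε) (_ : ε ≤ 1) (𝓝 : NUFFT 𝓜.L) (_ : 𝓝.HasTolerance 𝓜.modes c ε),
      (∀ u : Phase Np, ‖𝓜.rhsError 𝓝 u‖ ≤ K * ε) ∧
      ∀ u w : Phase Np, ‖𝓜.rhsError 𝓝 u - 𝓜.rhsError 𝓝 w‖ ≤ K * ε * ‖u - w‖ := by
  set k : ℝ := ∑ l : 𝓜.modes, ∑ a, |waveVector 𝓜.L l a| with hk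
  have hk0 : 0 ≤ k := by positivity
  have hW := 𝓜.fieldConst_nonneg (Np := Np)
  -- The sign of `c` is not assumed, hence `|c|`; the quadratic error term is absorbed using `ε ≤
  -- 1`.
  set K : ℝ := |𝓜.charge / 𝓜.mass| * (𝓜.fieldConst Np * (|c| * (2 + 2 * k + 2 * |c|))) with hK
  have hK0 : 0 ≤ K := by positivity
  refine ⟨K, hK0, fun ε hε hε1 𝓝 htol => ?_⟩
  have hη : |c| * ε ≤ |c| := mul_le_of_le_one_right (abs_nonneg _) hε1
  have hη0 : 0 ≤ |c| * ε := by positivity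
  have hcε : c * ε ≤ |c| * ε := by gcongr; exact le_abs_self c
  have hp : ∀ (x : Fin Np → Vec3) (l : 𝓜.modes) (j : Fin Np),
      ‖𝓜.nufft 𝓝 x l j - 𝓜.nudft x l j‖ ≤ |c| * ε := fun x l j =>
    (htol l l.2 (x j) (x j)).1.trans hcε
  have hpp : ∀ (x y : Fin Np → Vec3) (l : 𝓜.modes) (j : Fin Np),
      ‖(𝓜.nufft 𝓝 x l j - 𝓜.nudft x l j) - (𝓜.nufft 𝓝 y l j - 𝓜.nudft y l j)‖ ≤
        |c| * ε * ‖x - y‖ := fun x y l j =>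
    (htol l l.2 (x j) (y j)).2.trans (by gcongr; exact norm_le_pi_norm (x - y) j)
  have ha : ∀ (x : Fin Np → Vec3) (l : 𝓜.modes) (j : Fin Np), ‖𝓜.nudft x l j‖ ≤ 1 :=
    fun x l j => (norm_fourierExp _ _ _).le
  have haa : ∀ (x y : Fin Np → Vec3) (l : 𝓜.modes) (j : Fin Np),
      ‖𝓜.nudft x l j - 𝓜.nudft y l j‖ ≤ k * ‖x - y‖ := fun x y l j =>
    (norm_fourierExp_sub_le 𝓜.L l (x j) (y j)).trans (by
      gcongr
      · exact Finset.single_le_sum (f := fun l : 𝓜.modes => ∑ a, |waveVector 𝓜.L l a|)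
          (fun _ _ => by positivity) (Finset.mem_univ l)
      · exact norm_le_pi_norm (x - y) j)
  constructor
  · intro u
    refine norm_prod_le_iff.2 ⟨by rw [rhsError_fst, norm_zero]; positivity, ?_⟩
    refine (pi_norm_le_iff_of_nonneg (by positivity)).2 fun j =>
      (pi_norm_le_iff_of_nonneg (by positivity)).2 fun a => ?_
    rw [rhsError_snd, norm_mul, Real.norm_eq_abs, Real.norm_eq_abs]
    have h := 𝓜.abs_re_sum_fieldCoeff_le a (b := |c| * ε * (2 + |c| * ε)) (by positivity)
      fun i l => norm_prod_error_le (ha u.1 l j) (ha u.1 l i) (hp u.1 l j) (hp u.1 l i)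
    calc _ ≤ |𝓜.charge / 𝓜.mass| * (𝓜.fieldConst Np * (|c| * ε * (2 + |c| * ε))) := by gcongr
      _ ≤ |𝓜.charge / 𝓜.mass| * (𝓜.fieldConst Np * (|c| * ε * (2 + 2 * k + 2 * |c|))) := by
          have : 2 + |c| * ε ≤ 2 + 2 * k + 2 * |c| := by linarith [abs_nonneg c]
          gcongr
      _ = K * ε := by rw [hK]; ring
  · intro u w
    refine norm_prod_le_iff.2 ⟨by simp only [Prod.fst_sub, rhsError_fst, sub_self, norm_zero];
                                  positivity, ?_⟩
    refine (pi_norm_le_iff_of_nonneg (by positivity)).2 fun j =>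
      (pi_norm_le_iff_of_nonneg (by positivity)).2 fun a => ?_
    simp only [Prod.snd_sub, Pi.sub_apply]
    rw [rhsError_snd, rhsError_snd, ← mul_sub, ← Complex.sub_re, ← Finset.sum_sub_distrib]
    simp only [← Finset.sum_sub_distrib, ← mul_sub]
    rw [norm_mul, Real.norm_eq_abs, Real.norm_eq_abs]
    have h := 𝓜.abs_re_sum_fieldCoeff_le a
      (b := |c| * ε * (2 + 2 * k + 2 * (|c| * ε)) * ‖u.1 - w.1‖) (by positivity)
      fun i l => norm_prod_error_sub_le (norm_nonneg _) hk0 (ha u.1 l i) (ha w.1 l j)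
        (hp u.1 l i) (hp w.1 l j) (haa u.1 w.1 l j) (haa u.1 w.1 l i)
        (hpp u.1 w.1 l j) (hpp u.1 w.1 l i)
    calc _ ≤ |𝓜.charge / 𝓜.mass| *
            (𝓜.fieldConst Np * (|c| * ε * (2 + 2 * k + 2 * (|c| * ε)) * ‖u.1 - w.1‖)) := by gcongr
      _ ≤ |𝓜.charge / 𝓜.mass| *
            (𝓜.fieldConst Np * (|c| * ε * (2 + 2 * k + 2 * |c|) * ‖u - w‖)) := by
          gcongr
          exact norm_fst_le (u - w)
      _ = K * ε * ‖u - w‖ := by rw [hK]; ring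

/-! ### Confinement of trajectories -/

theorem dotProduct_le_three_mul_sq {v : Vec3} {r : ℝ} (hv : ‖v‖ ≤ r) : v ⬝ᵥ v ≤ 3 * r ^ 2 := by
  have h : ∀ a, v a * v a ≤ r ^ 2 := fun a => by
    have := (norm_le_pi_norm v a).trans hv
    rw [← sq]
    exact sq_le_sq' (abs_le.1 this).1 (abs_le.1 this).2
  have := Finset.sum_le_card_nsmul Finset.univ (fun a => v a * v a) (r ^ 2) fun a _ => h a
  simpa [dotProduct] using this

theorem norm_le_sqrt_dotProduct_self (v : Vec3) : ‖v‖ ≤ Real.sqrt (v ⬝ᵥ v) := by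
  refine (pi_norm_le_iff_of_nonneg (Real.sqrt_nonneg _)).2 fun a => ?_
  refine Real.le_sqrt_of_sq_le ?_
  rw [Real.norm_eq_abs, sq_abs, sq]
  exact Finset.single_le_sum (f := fun a => v a * v a) (fun a _ => mul_self_nonneg _)
    (Finset.mem_univ a)

/-- The magnetic force does no work, so that velocities stay bounded under a bounded force. -/
theorem norm_velocity_le {v h b : ℝ → Vec3} {γ H R T : ℝ}
    (hv : ∀ t, HasDerivAt v (h t + γ • crossProduct (v t) (b t)) t) (hH : ∀ t, ‖h t‖ ≤ H)
    (hR : ‖v 0‖ ≤ R) {t : ℝ} (ht : t ∈ Icc 0 T) :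
    ‖v t‖ ≤ Real.sqrt ((3 * R ^ 2 + 3 * H ^ 2 * T) * Real.exp T) := by
  have hw : ∀ t, HasDerivAt (fun t => v t ⬝ᵥ v t) (2 * (v t ⬝ᵥ h t)) t := by
    intro t
    have h1 := HasDerivAt.fun_sum (u := Finset.univ) fun a _ =>
      ((hasDerivAt_pi.1 (hv t)) a).mul ((hasDerivAt_pi.1 (hv t)) a)
    refine h1.congr_deriv ?_
    have h2 : v t ⬝ᵥ crossProduct (v t) (b t) = 0 := dot_self_cross _ _
    have h3 : 2 * (v t ⬝ᵥ h t) =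
        2 * (v t ⬝ᵥ (h t + γ • crossProduct (v t) (b t))) := by
      rw [dotProduct_add, dotProduct_smul, h2, smul_zero, add_zero]
    rw [h3, dotProduct, Finset.mul_sum]
    exact Finset.sum_congr rfl fun a _ => by ring
  have hnn : ∀ t, 0 ≤ v t ⬝ᵥ v t := fun t => Finset.sum_nonneg fun a _ => mul_self_nonneg _
  -- Grönwall for the squared Euclidean speed, with rate 1 from 2 v·h ≤ v·v + h·h. The factors 3
  -- compare the Euclidean norm with the sup norm.
  have key := norm_le_mul_exp_of_norm_deriv_le (y := fun t => v t ⬝ᵥ v t) (K := 1)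
    (ε := 3 * H ^ 2) zero_le_one (by positivity) hw (T := T) (fun s _ => ?_) ht
  · refine (norm_le_sqrt_dotProduct_self _).trans (Real.sqrt_le_sqrt ?_)
    rw [Real.norm_of_nonneg (hnn t), Real.norm_of_nonneg (hnn 0), one_mul] at key
    refine key.trans ?_
    have := ht.2
    have := dotProduct_le_three_mul_sq hR
    have := hnn 0
    have := ht.1
    have : 0 ≤ T := ht.1.trans ht.2
    gcongr
  · have h1 := dotProduct_le_three_mul_sq (hH s)
    have h2 : ∀ x y : Vec3, 2 * |x ⬝ᵥ y| ≤ x ⬝ᵥ x + y ⬝ᵥ y := by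
      intro x y
      simp only [dotProduct, Fin.sum_univ_three]
      rw [← abs_two, ← abs_mul, abs_le]
      constructor <;>
      nlinarith [sq_nonneg (x 0 - y 0), sq_nonneg (x 1 - y 1), sq_nonneg (x 2 - y 2),
        sq_nonneg (x 0 + y 0), sq_nonneg (x 1 + y 1), sq_nonneg (x 2 + y 2)]
    rw [Real.norm_of_nonneg (hnn s), norm_mul, Real.norm_ofNat, Real.norm_eq_abs]
    linarith [h2 (v s) (h s)]

/-- The electric field is bounded independently of the positions and the magnetic force does no
work, so speeds, and then positions, stay bounded on `[0, T]`. The set serves every perturbation of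
size at most `b` without a position component, hence both flows at once. -/
theorem exists_confining_set (D : Set (Phase Np))
    (hD : (∃ B₀ : Vec3, ∀ x, 𝓜.Bext x = B₀) ∨ Bornology.IsBounded D) (T b : ℝ) :
    ∃ (S : Set (Phase Np)) (A B : ℝ), 0 ≤ A ∧ 0 ≤ B ∧ QuadLip (𝓜.rhs 𝓜.nudft) S A B ∧
      ∀ (g : Phase Np → Phase Np) (y : ℝ → Phase Np), (∀ u, (g u).1 = 0) → (∀ u, ‖g u‖ ≤ b) →
        (∀ t, HasDerivAt y (𝓜.rhs 𝓜.nudft (y t) + g (y t)) t) → y 0 ∈ D →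
        ∀ t ∈ Icc 0 T, y t ∈ S := by
  rcases hD with ⟨B₀, hB₀⟩ | hD
  · obtain ⟨A, B, hA, hB, h⟩ := 𝓜.hasQuadLip_rhs_nudft_of_const (Np := Np) hB₀ univ
    exact ⟨univ, A, B, hA, hB, h, fun _ _ _ _ _ _ _ _ => mem_univ _⟩
  obtain ⟨R, hR⟩ := hD.exists_norm_le
  set H : ℝ := |𝓜.charge / 𝓜.mass| * 𝓜.fieldConst Np + b
  set V : ℝ := Real.sqrt ((3 * R ^ 2 + 3 * H ^ 2 * T) * Real.exp T) with hV
  obtain ⟨A, B, hA, hB, h⟩ := 𝓜.hasQuadLip_rhs_nudft_closedBall (Np := Np) (max (R + V * T) V)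
  refine ⟨_, A, B, hA, hB, h, fun g y hg1 hg hy hy0 t ht => ?_⟩
  have hV0 : 0 ≤ V := Real.sqrt_nonneg _
  have hy0R := hR _ hy0
  have hvel : ∀ t ∈ Icc 0 T, ‖(y t).2‖ ≤ V := by
    intro t ht
    refine (pi_norm_le_iff_of_nonneg hV0).2 fun j => ?_
    refine norm_velocity_le (v := fun t => (y t).2 j) (γ := 𝓜.charge / 𝓜.mass)
      (h := fun t => (𝓜.charge / 𝓜.mass) • 𝓜.electricField (𝓜.scatter (𝓜.nudft (y t).1)) j +
        (g (y t)).2 j) (b := fun t => 𝓜.Bext ((y t).1 j)) (fun t => ?_) (fun t => ?_) ?_ ht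
    · have h1 := hasDerivAt_pi.1 ((hy t).snd) j
      refine h1.congr_deriv ?_
      simp only [rhs, Prod.snd_add, Pi.add_apply, smul_add]
      abel
    · refine (norm_add_le _ _).trans (add_le_add ?_ ?_)
      · rw [norm_smul, Real.norm_eq_abs]
        exact mul_le_mul_of_nonneg_left (𝓜.norm_electricField_nudft_le _ _) (abs_nonneg _)
      · exact (norm_le_pi_norm _ j).trans ((norm_snd_le _).trans (hg _))
    · exact (norm_le_pi_norm _ j).trans ((norm_snd_le _).trans hy0R)
  have hpos : ‖(y t).1‖ ≤ R + V * T := by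
    have h1 := norm_le_mul_exp_of_norm_deriv_le (y := fun t => (y t).1) (K := 0) (ε := V)
      le_rfl hV0 (fun t => (hy t).fst) (T := T) (fun s hs => ?_) ht
    · simp only [zero_mul, Real.exp_zero, mul_one] at h1
      refine h1.trans ?_
      have := ht.2
      gcongr
      exact (norm_fst_le _).trans hy0R
    · simpa [rhs, hg1] using hvel s hs
  rw [mem_closedBall_zero_iff]
  exact norm_prod_le_iff.2 ⟨hpos.trans (le_max_left _ _), (hvel t ht).trans (le_max_right _ _)⟩

end PIFModel

/-- Equivalence of a norm, given as a definite seminorm, with the norm of a finite-dimensional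
space. -/
theorem Seminorm.exists_norm_equivalence {E : Type*} [NormedAddCommGroup E] [NormedSpace ℝ E]
    [FiniteDimensional ℝ E] (ν : Seminorm ℝ E) (hν : ∀ u, ν u = 0 → u = 0) :
    ∃ a b : ℝ, 0 ≤ a ∧ 0 ≤ b ∧ ∀ u, ‖u‖ ≤ a * ν u ∧ ν u ≤ b * ‖u‖ := by
  rcases subsingleton_or_nontrivial E with h | h
  · refine ⟨0, 0, le_rfl, le_rfl, fun u => ?_⟩
    rw [Subsingleton.elim u 0]; simp
  -- A seminorm is convex, and finite-dimensional convex functions are continuous; its extrema on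
  -- the unit sphere give the constants.
  have hcont : ContinuousOn ν (Metric.sphere 0 1) :=
    (ν.convexOn.continuousOn isOpen_univ).mono (subset_univ _)
  have hc : IsCompact (Metric.sphere (0 : E) 1) :=
    have := FiniteDimensional.proper ℝ E; isCompact_sphere _ _
  have hne : (Metric.sphere (0 : E) 1).Nonempty := NormedSpace.sphere_nonempty.2 zero_le_one
  obtain ⟨x, hx, hxmin⟩ := hc.exists_isMinOn hne hcont
  obtain ⟨y, hy, hymax⟩ := hc.exists_isMaxOn hne hcont
  have hx0 : 0 < ν x := by
    refine (apply_nonneg ν x).lt_of_ne fun h0 => ?_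
    have := hν x h0.symm
    simp [this] at hx
  refine ⟨(ν x)⁻¹, ν y, by positivity, apply_nonneg ν y, fun u => ?_⟩
  rcases eq_or_ne u 0 with rfl | hu
  · simp
  have hu0 : 0 < ‖u‖ := norm_pos_iff.2 hu
  have hmem : ‖u‖⁻¹ • u ∈ Metric.sphere (0 : E) 1 := by
    rw [mem_sphere_zero_iff_norm, norm_smul, norm_inv, norm_norm, inv_mul_cancel₀ hu0.ne']
  have e : ν (‖u‖⁻¹ • u) = ‖u‖⁻¹ * ν u := by
    rw [map_smul_eq_mul, norm_inv, norm_norm]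
  have h1 : ν x ≤ ‖u‖⁻¹ * ν u := e ▸ hxmin hmem
  have h2 : ‖u‖⁻¹ * ν u ≤ ν y := e ▸ hymax hmem
  rw [inv_mul_eq_div] at h1 h2
  rw [le_div_iff₀ hu0] at h1
  rw [div_le_iff₀ hu0] at h2
  refine ⟨?_, h2⟩
  rw [inv_mul_eq_div, le_div_iff₀ hx0]
  linarith

/-! ### The Lipschitz constant of `F - G`. -/

namespace PIFModel

variable (𝓜 : PIFModel) {Np : ℕ}

/-- The flows with NUDFT and with NUFFT differ by `O(ε t)` in the Lipschitz norm. -/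
theorem exists_flow_error_bound (D : Set (Phase Np))
    (hD : (∃ B₀ : Vec3, ∀ x, 𝓜.Bext x = B₀) ∨ Bornology.IsBounded D) {τ : ℝ} (hτ : 0 ≤ τ)
    (c : ℝ) : ∃ K : ℝ, 0 ≤ K ∧ ∀ (ε : ℝ) (_ : 0 < ε) (_ : ε ≤ 1) (𝓝 : NUFFT 𝓜.L)
      (_ : 𝓝.HasTolerance 𝓜.modes c ε) (φ ψ : ℝ → Phase Np → Phase Np)
      (_ : IsFlow (𝓜.rhs 𝓜.nudft) φ) (_ : IsFlow (𝓜.rhs (𝓜.nufft 𝓝)) ψ),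
      ∀ u ∈ D, ∀ w ∈ D, ∀ t ∈ Icc 0 τ, ‖ψ t u - φ t u‖ ≤ K * ε * t ∧
        ‖(ψ t u - φ t u) - (ψ t w - φ t w)‖ ≤ K * ε * t * ‖u - w‖ := by
  obtain ⟨Kg, hKg, hg⟩ := 𝓜.exists_rhsError_bound Np c
  -- As `ε ≤ 1`, the bound `Kg` covers every admissible perturbation, so `S`, `A` and `B` do not
  -- depend on `ε`.
  obtain ⟨S, A, B, hA, hB, hf, hS⟩ := 𝓜.exists_confining_set D hD τ Kg
  set X := Real.exp (A * τ) with hX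
  set Y := (2 * B * τ * X + 1) * Real.exp ((A + Kg) * τ) * X with hY
  have hX0 : 0 ≤ X := by positivity
  have hY0 : 0 ≤ Y := by positivity
  refine ⟨Kg * (X + Y), by positivity, fun ε hε hε1 𝓝 htol φ ψ hφ hψ u hu w hw t ht => ?_⟩
  obtain ⟨h1, h2⟩ := hg ε hε hε1 𝓝 htol
  have hψ' : IsFlow (fun u => 𝓜.rhs 𝓜.nudft u + 𝓜.rhsError 𝓝 u) ψ := by
    have e : (fun u : Phase Np => 𝓜.rhs 𝓜.nudft u + 𝓜.rhsError 𝓝 u) = 𝓜.rhs (𝓜.nufft 𝓝) := by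
      funext u; rw [rhsError, add_sub_cancel]
    rwa [e]
  have hκ : Kg * ε ≤ Kg := mul_le_of_le_one_right hKg hε1
  have hφS : ∀ z ∈ D, ∀ s ∈ Icc 0 τ, φ s z ∈ S := fun z hz =>
    hS (fun _ => 0) (fun s => φ s z) (fun _ => rfl) (fun _ => by simpa using hKg)
      (fun s => by simpa using (hφ z).2 s) (by simpa only [(hφ z).1] using hz)
  have hψS : ∀ z ∈ D, ∀ s ∈ Icc 0 τ, ψ s z ∈ S := fun z hz =>
    hS (𝓜.rhsError 𝓝) (fun s => ψ s z) (𝓜.rhsError_fst 𝓝) (fun v => (h1 v).trans hκ)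
      (hψ' z).2 (by simpa only [(hψ z).1] using hz)
  obtain ⟨k1, k2⟩ := hφ.norm_perturbed_sub_le hψ' hf hA hB (by positivity) hκ h1 h2
    (hφS u hu) (hφS w hw) (hψS u hu) (hψS w hw) ht
  have ht0 := ht.1
  constructor
  · calc _ ≤ Kg * ε * t * X := k1
      _ ≤ Kg * ε * t * (X + Y) := by gcongr; linarith
      _ = _ := by ring
  · calc _ ≤ Kg * ε * t * Y * ‖u - w‖ := k2
      _ ≤ Kg * ε * t * (X + Y) * ‖u - w‖ := by gcongr; linarith
      _ = _ := by ring

/-- Lipschitz bound for the difference `F - G` of the fine and the coarse propagator. -/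
theorem exists_propagator_diff_bound (ν : Seminorm ℝ (Phase Np)) (hν : ∀ u, ν u = 0 → u = 0)
    (D : Set (Phase Np)) (hD : (∃ B₀ : Vec3, ∀ x, 𝓜.Bext x = B₀) ∨ Bornology.IsBounded D)
    (T : ℝ) :
    ∃ (Cnufft : ℝ → ℝ) (Ctime : ℕ → ℝ → ℝ), (∀ c, 0 ≤ Cnufft c) ∧ (∀ p C, 0 ≤ Ctime p C) ∧
      ∀ (c Clte : ℝ) (p : ℕ) (ε : ℝ) (_ : 0 < ε) (_ : ε ≤ 1)
        (𝓝 : NUFFT 𝓜.L) (_ : 𝓝.HasTolerance 𝓜.modes c ε)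
        (φ ψ : ℝ → Phase Np → Phase Np)
        (_ : IsFlow (𝓜.rhs 𝓜.nudft) φ) (_ : IsFlow (𝓜.rhs (𝓜.nufft 𝓝)) ψ)
        (ng : ℕ) (_ : 1 ≤ ng) (dt : ℝ) (_ : 0 < dt) (_ : ng * dt ≤ T)
        (Φ : Phase Np → Phase Np) (_ : LocalTruncationBound ν D ψ Φ dt p Clte)
        (u w : Phase Np) (_ : ∀ i < ng, Φ^[i] u ∈ D) (_ : ∀ i < ng, Φ^[i] w ∈ D),
        ν ((φ (ng * dt) u - Φ^[ng] u) - (φ (ng * dt) w - Φ^[ng] w)) ≤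
          (Cnufft c * ε + Ctime p Clte * (ng * dt) * dt ^ p) * ν (u - w) := by
  obtain ⟨a, b, ha, hb, hab⟩ := ν.exists_norm_equivalence hν
  set τ : ℝ := max T 0
  have hτ : 0 ≤ τ := le_max_right _ _
  -- Only the unperturbed flow is followed here, hence the bound `0`; the horizon is doubled for the
  -- telescoping argument.
  obtain ⟨S, A, B, hA, hB, hf, hS⟩ := 𝓜.exists_confining_set D hD (2 * τ) 0
  choose K hK0 hK using 𝓜.exists_flow_error_bound D hD hτ
  set Q : ℝ := (1 + 2 * B * τ) * Real.exp (5 * A * τ) with hQ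
  have hQ0 : 0 ≤ Q := by positivity
  -- Passing from `ν` to the ambient norm costs `a` for the size of the defect and `a * b` for its
  -- Lipschitz constant; `1 + b` covers both.
  set C' : ℝ → ℝ := fun C => a * (1 + b) * |C| with hC'
  have hC'0 : ∀ C, 0 ≤ C' C := fun C => by positivity
  refine ⟨fun c => a * b * Q * τ * (2 * K c * Real.exp (4 * τ * K c)),
    fun p C => a * b * Q * (2 * C' C * Real.exp (4 * τ * (C' C * τ ^ p))),
    fun c => by have := hK0 c; positivity, fun p C => by have := hC'0 C; positivity, ?_⟩
  intro c Clte p ε hε hε1 𝓝 htol φ ψ hφ hψ ng hng dt hdt hT Φ hΦ u w hu hw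
  have hKc := hK0 c
  have hC := hC'0 Clte
  have hτT : ng * dt ≤ τ := hT.trans (le_max_left _ _)
  have hdtτ : dt ≤ τ := le_trans (le_mul_of_one_le_left hdt.le (by exact_mod_cast hng)) hτT
  set ρ := K c * ε + C' Clte * dt ^ p with hρ
  have hρ0 : 0 ≤ ρ := by positivity
  have herr := fun u hu w hw => hK c ε hε hε1 𝓝 htol φ ψ hφ hψ u hu w hw dt ⟨hdt.le, hdtτ⟩
  have hloc : ∀ u ∈ D, ∀ w ∈ D, ‖Φ u - ψ dt u‖ ≤ C' Clte * dt ^ p * dt ∧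
      ‖(Φ u - ψ dt u) - (Φ w - ψ dt w)‖ ≤ C' Clte * dt ^ p * dt * ‖u - w‖ := by
    intro u hu w hw
    obtain ⟨h1, h2⟩ := hΦ u hu w hw
    have hp : 0 ≤ dt ^ (p + 1) := by positivity
    have habs : Clte * dt ^ (p + 1) ≤ |Clte| * dt ^ (p + 1) := by
      gcongr; exact le_abs_self _
    constructor
    · calc _ ≤ a * ν (Φ u - ψ dt u) := (hab _).1
        _ ≤ a * (1 * |Clte| * dt ^ (p + 1)) := by rw [one_mul]; gcongr; exact h1.trans habs
        _ ≤ a * ((1 + b) * |Clte| * dt ^ (p + 1)) := by gcongr; linarith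
        _ = _ := by simp only [hC']; ring
    · calc _ ≤ a * ν ((Φ u - ψ dt u) - (Φ w - ψ dt w)) := (hab _).1
        _ ≤ a * (|Clte| * dt ^ (p + 1) * (b * ‖u - w‖)) := by
          gcongr
          exact h2.trans (mul_le_mul habs (hab _).2 (apply_nonneg _ _) (by positivity))
        _ ≤ a * (|Clte| * dt ^ (p + 1) * ((1 + b) * ‖u - w‖)) := by gcongr; linarith
        _ = _ := by simp only [hC']; ring
  have hmain := hφ.norm_sub_iterate_sub_le (T := τ)
    (fun s hs t u => hφ.add_apply 𝓜.hasQuadLip_rhs_nudft_closedBall hs t u) hf hA hB (D := D)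
    (fun z hz => hS (fun _ => 0) (fun s => φ s z) (fun _ => rfl) (fun _ => by simp)
      (fun s => by simpa using (hφ z).2 s) (by simpa only [(hφ z).1] using hz))
    hdt hρ0 (Φ := Φ) (fun z hz => ?_) (fun z hz y hy => ?_) hτT hu hw
  rotate_left
  · have h1 := (herr z hz z hz).1
    have h2 := (hloc z hz z hz).1
    rw [show Φ z - φ dt z = (Φ z - ψ dt z) + (ψ dt z - φ dt z) by abel]
    refine (norm_add_le _ _).trans ((add_le_add h2 h1).trans (le_of_eq ?_))
    rw [hρ]; ring
  · have h1 := (herr z hz y hy).2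
    have h2 := (hloc z hz y hy).2
    rw [show Φ z - φ dt z - (Φ y - φ dt y) = ((Φ z - ψ dt z) - (Φ y - ψ dt y)) +
      ((ψ dt z - φ dt z) - (ψ dt y - φ dt y)) by abel]
    refine (norm_add_le _ _).trans ((add_le_add h2 h1).trans (le_of_eq ?_))
    rw [hρ]; ring
  -- Decouples the exponential, so that `Cnufft` does not involve `Clte` and `Ctime` does not
  -- involve `c`.
  have hsep : ρ * Real.exp (2 * τ * ρ) ≤ 2 * (K c * ε) * Real.exp (4 * τ * K c) +
      2 * (C' Clte * dt ^ p) * Real.exp (4 * τ * (C' Clte * τ ^ p)) := by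
    refine (add_mul_exp_le (a := K c * ε) (b := C' Clte * dt ^ p) (t := 2 * τ)
      (by positivity) (by positivity) (by positivity)).trans ?_
    have e : 2 * (2 * τ) = 4 * τ := by ring
    rw [e]
    have : K c * ε ≤ K c := mul_le_of_le_one_right hKc hε1
    gcongr
  set R₁ := 2 * (K c * ε) * Real.exp (4 * τ * K c) with hR₁
  set R₂ := 2 * (C' Clte * dt ^ p) * Real.exp (4 * τ * (C' Clte * τ ^ p)) with hR₂
  have hR₁0 : 0 ≤ R₁ := by positivity
  have hν0 := apply_nonneg ν (u - w)
  calc _ ≤ b * ‖(φ (ng * dt) u - Φ^[ng] u) - (φ (ng * dt) w - Φ^[ng] w)‖ := (hab _).2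
    _ ≤ b * (ng * dt * (ρ * Real.exp (2 * τ * ρ)) * Q * ‖u - w‖) := by gcongr
    _ ≤ b * (ng * dt * (R₁ + R₂) * Q * (a * ν (u - w))) := by
        gcongr
        exact (hab _).1
    _ = (a * b * Q * (ng * dt) * R₁ + a * b * Q * (ng * dt) * R₂) * ν (u - w) := by ring
    -- In the NUFFT part the factor `ng * dt` is given up for `τ`; the time part keeps it as `ΔT`.
    _ ≤ (a * b * Q * τ * R₁ + a * b * Q * (ng * dt) * R₂) * ν (u - w) := by gcongr
    _ = _ := by rw [hR₁, hR₂]; ring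

end PIFModel

/-! ### The parareal error bound. -/

theorem mainTheorem2 (𝓜 : PIFModel) (Np : ℕ)
    (ν : Seminorm ℝ (Phase Np)) (hν : ∀ u, ν u = 0 → u = 0)
    (D : Set (Phase Np))
    (hD : (∃ B₀ : Vec3, ∀ x, 𝓜.Bext x = B₀) ∨ Bornology.IsBounded D)
    (T : ℝ) :
    ∃ (Cnufft : ℝ → ℝ) (Ctime : ℕ → ℝ → ℝ),
      (∀ c, 0 ≤ Cnufft c) ∧ (∀ p C, 0 ≤ Ctime p C) ∧
      ∀ (c Clte : ℝ) (p : ℕ)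
        -- the NUFFT and its tolerance
        (ε : ℝ) (_ : 0 < ε) (_ : ε ≤ 1)
        (𝓝 : NUFFT 𝓜.L) (_ : 𝓝.HasTolerance 𝓜.modes c ε)
        -- exact flows of the PIF equations with NUDFT and with NUFFT
        (φ ψ : ℝ → Phase Np → Phase Np)
        (_ : IsFlow (𝓜.rhs 𝓜.nudft) φ) (_ : IsFlow (𝓜.rhs (𝓜.nufft 𝓝)) ψ)
        -- the coarse time integrator, with `ng` steps of size `dt` per time subdomain
        (ng : ℕ) (_ : 1 ≤ ng) (dt : ℝ) (_ : 0 < dt) (ΔT : ℝ) (_ : ΔT = ng * dt) (_ : ΔT ≤ T)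
        (Φ : Phase Np → Phase Np) (_ : LocalTruncationBound ν D ψ Φ dt p Clte)
        -- fine and coarse propagators
        (F G : Phase Np → Phase Np) (_ : F = φ ΔT) (_ : G = Φ^[ng])
        (Cpif : ℝ) (_ : ∀ u ∈ D, ∀ w ∈ D, ν (G u - G w) ≤ Cpif * ν (u - w))
        -- `N` time subdomains, initial condition and initial guess
        (N : ℕ) (u₀ : Phase Np) (g : ℕ → Phase Np)
        -- the coarse time steps start at states in `D`
        (_ : ∀ n < N, ∀ i < ng, Φ^[i] (φ (n * ΔT) u₀) ∈ D)
        (_ : ∀ k, ∀ n < N, ∀ i < ng, Φ^[i] (parareal F G u₀ g k n) ∈ D)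
        (k n : ℕ) (_ : n < N),
        ν (parareal F G u₀ g k (n + 1) - φ ((n + 1 : ℕ) * ΔT) u₀) ≤
          max 1 Cpif ^ ((n : ℤ) - (k : ℤ))
            * ((Cnufft c * ε + Ctime p Clte * ΔT * dt ^ p) ^ k / (k.factorial : ℝ))
            * (∏ j ∈ Finset.Icc 1 k, ((n : ℝ) + 1 - (j : ℝ)))
            * ⨆ m : Fin N,
                ν (parareal F G u₀ g 0 ((m : ℕ) + 1) - φ (((m : ℕ) + 1 : ℕ) * ΔT) u₀) := by
  obtain ⟨Cn, Ct, hCn, hCt, hdiff⟩ := 𝓜.exists_propagator_diff_bound ν hν D hD T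
  refine ⟨Cn, Ct, hCn, hCt, ?_⟩
  intro c Clte p ε hε hε1 𝓝 htol φ ψ hφ hψ ng hng dt hdt ΔT hΔT hT Φ hΦ F G hF hG Cpif hCpif
    N u₀ g hexact hiter k n hn
  have hΔT0 : 0 ≤ ΔT := by rw [hΔT]; positivity
  have hα : 0 ≤ Cn c * ε + Ct p Clte * ΔT * dt ^ p := by
    have := hCn c
    have := hCt p Clte
    positivity
  refine le_of_parareal_recursion (δ := ⨆ m : Fin N,
    ν (parareal F G u₀ g 0 ((m : ℕ) + 1) - φ (((m : ℕ) + 1 : ℕ) * ΔT) u₀))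
    (e := fun k n => ν (parareal F G u₀ g k n - φ ((n : ℕ) * ΔT) u₀)) hα (le_max_left 1 Cpif)
    (Real.iSup_nonneg fun _ => apply_nonneg _ _) (fun k => ?_) (fun n hn => ?_)
    (fun k n hn => ?_) k n hn
  · cases k <;> simp [parareal, (hφ u₀).1]
  · exact le_ciSup (f := fun m : Fin N =>
      ν (parareal F G u₀ g 0 ((m : ℕ) + 1) - φ (((m : ℕ) + 1 : ℕ) * ΔT) u₀))
      (Set.finite_range _).bddAbove ⟨n, hn⟩
  · set U := parareal F G u₀ g k n with hU
    set U' := parareal F G u₀ g (k + 1) n with hU'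
    set v := φ (n * ΔT) u₀ with hv
    have hUD := hiter k n hn
    have hUD' := hiter (k + 1) n hn
    have hvD := hexact n hn
    have hstep : φ ((n + 1 : ℕ) * ΔT) u₀ = F v := by
      rw [hF, hv, ← hφ.add_apply 𝓜.hasQuadLip_rhs_nudft_closedBall hΔT0]
      congr 1
      push_cast; ring
    have e : parareal F G u₀ g (k + 1) (n + 1) - φ ((n + 1 : ℕ) * ΔT) u₀ =
        ((F U - G U) - (F v - G v)) + (G U' - G v) := by
      rw [hstep, parareal]
      abel
    have h1 : ν ((F U - G U) - (F v - G v)) ≤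
        (Cn c * ε + Ct p Clte * ΔT * dt ^ p) * ν (U - v) := by
      rw [hF, hG, hΔT]
      exact hdiff c Clte p ε hε hε1 𝓝 htol φ ψ hφ hψ ng hng dt hdt (hΔT ▸ hT) Φ hΦ U v hUD hvD
    -- The instance `i = 0`, available because `1 ≤ ng`, places `U'` and `v` themselves in `D`.
    have h2 : ν (G U' - G v) ≤ max 1 Cpif * ν (U' - v) :=
      (hCpif U' (hUD' 0 hng) v (hvD 0 hng)).trans
        (mul_le_mul_of_nonneg_right (le_max_right _ _) (apply_nonneg _ _))
    simp only [e]
    exact (map_add_le_add ν _ _).trans (add_le_add h1 h2)
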